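/- \textbf{Conventions.} Complexes are abstract simplicial complexes with vertices in $\mathbb N$; the empty simplex is not counted as a face but is allowed as a factor in joins. For a simplex $A$ of a complex $K$ let $lk(A,K)$ be its link and $Q(A,K)$ the complex of the simplexes of $K$ that do not contain $A$. For an integer $a$ that is not a vertex of $K$, the \emph{stellar subdivision} of $K$ at $A$ is $(A\;a)K = a\star\partial A\star lk(A,K)+Q(A,K)$; a \emph{weld} is the inverse of a stellar subdivision. Two complexes are \emph{stellar equivalent} ($\sim$) if one is obtained from the other by a finite sequence of subdivisions, welds and renamings of vertices. A \emph{stellar $k$-ball} is a complex $\sim (1\;2\;\dots\;k+1)$, a \emph{stellar $k$-sphere} is a complex $\sim \partial(1\;2\;\dots\;k+2)$ (the $(-1)$-sphere is the empty complex). A \emph{stellar $n$-manifold} is a complex in which the link of every vertex is a stellar $(n-1)$-ball or a stellar $(n-1)$-sphere. The \emph{generators} of an $n$-dimensional complex are its $n$-simplexes. $M$ is \emph{connected} if its standard geometric realization is connected, and \emph{closed} if the sum over $\mathbb Z/2$ of the boundaries of its generators vanishes. A \emph{regular equivalence} $\simeq$ on an $(n-1)$-dimensional complex $S$ is a pair of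 equivalence relations, one on the vertices and one on the generators of $S$, such that (i) no generator has two distinct equivalent vertices; (ii) every generator $g$ is equivalent to at most one generator $p\neq g$, and if $g\simeq p$ then every vertex of $g$ is equivalent to some vertex of $p$. If $a$ is not a vertex of $S$, then $a\star(S/\simeq)$ denotes the quotient of the simplexes of the cone $a\star S$ in which equivalent vertices of $S$ are identified and, for equivalent generators $g\simeq p$ of $S$, each face of $g$ is identified with the face of $p$ that has equivalent vertices, while distinct simplexes of $a\star S$ that contain $a$ remain distinct. It is in general not a simplicial complex, since several of its simplexes may have the same vertices; it is regarded as a generalized simplicial complex, that is, a partially ordered set of simplexes (ordered by the face relation) with a least element, the empty simplex, in which the faces of each simplex form a finite Boolean lattice. Stellar subdivision of a generalized simplicial complex $P$ at a non-empty simplex $A$ keeps the simplexes that do not contain $A$ and adds, for every simplex $x$ that does not contain $A$ and every minimal simplex $z$ that contains both $x$ and $A$, a new simplex $a\star x$ inside $z$. Its simplexes are thus the pairs $(x,x)$ (old) and $(x,z)$ (new), with $(x,z)\le(x',z')$ if and only if $x\le x'$ and $z\le z'$. For simplicial complexes this is the usual stellar subdivision. Stellar equivalence of generalized simplicial complexes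 is defined by finite sequences of subdivisions, their inverses, and isomorphisms. A simplicial complex $M$ \emph{admits} $a\star(S/\simeq)$ if the two are stellar equivalent in this sense. \textbf{Theorem (Stellar Structure).} Let $M$ be a connected stellar $n$-manifold with a finite number of generators. Then there are a stellar $(n-1)$-sphere $S$, a vertex $a\notin S$ and a regular equivalence $\simeq$ on $S$ such that $M$ is stellar equivalent to $$N=a\star(S/\simeq).$$ Moreover, if $M$ is closed, then $S$ and $\simeq$ can be chosen here so that for every generator $g\in S$ there exists exactly one generator $p\in S$ such that $p\neq g$ and $g\simeq p$. -/

import Mathlib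

namespace Stellar

/-- Abstract simplicial complexes whose vertices are (some of the) natural numbers. The empty
simplex is never recorded as a face. -/
abbrev Complex := PreAbstractSimplicialComplex ℕ

/-- The simplexes of `K` together with the empty simplex. -/
def augFaces (K : Complex) : Set (Finset ℕ) := {s | s = ∅ ∨ s ∈ K.faces}

theorem nonempty_of_mem {K : Complex} {s : Finset ℕ} (hs : s ∈ K.faces) : s.Nonempty :=
  (K.isRelLowerSet_faces hs).1

theorem mem_of_subset {K : Complex} {s t : Finset ℕ} (hs : s ∈ K.faces) (hts : t ⊆ s)
    (ht : t.Nonempty) : t ∈ K.faces :=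
  (K.isRelLowerSet_faces hs).2 hts ht

theorem augFaces_of_subset {K : Complex} {s t : Finset ℕ} (hs : s ∈ augFaces K) (hts : t ⊆ s) :
    t ∈ augFaces K := by
  rcases t.eq_empty_or_nonempty with rfl | ht
  · exact Or.inl rfl
  · rcases hs with rfl | hs
    · exact Or.inl (Finset.subset_empty.mp hts)
    · exact Or.inr (mem_of_subset hs hts ht)

/-- The set of vertices of `K`. -/
def vertices (K : Complex) : Set ℕ := {v | {v} ∈ K.faces}

/-- The simplexes of `K` with `m` vertices, i.e. the `(m-1)`-simplexes of `K`. For a complex of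
dimension `m - 1` these are its generators. -/
def generators (m : ℕ) (K : Complex) : Set (Finset ℕ) := {s | s ∈ K.faces ∧ s.card = m}

/-- The full simplex with vertex set `A`. -/
def simplex (A : Finset ℕ) : Complex where
  faces := {s | s.Nonempty ∧ s ⊆ A}
  isRelLowerSet_faces := fun _ hs => ⟨hs.1, fun _ ht hne => ⟨hne, ht.trans hs.2⟩⟩

/-- The boundary complex `∂A` of the simplex `A`. -/
def simplexBoundary (A : Finset ℕ) : Complex where
  faces := {s | s.Nonempty ∧ s ⊂ A}
  isRelLowerSet_faces := fun _ hs => ⟨hs.1, fun _ ht hne => ⟨hne, lt_of_le_of_lt ht hs.2⟩⟩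

/-- The join `K ⋆ L` (used for complexes without common vertices). -/
def join (K L : Complex) : Complex where
  faces := {s | s.Nonempty ∧ ∃ x ∈ augFaces K, ∃ y ∈ augFaces L, Disjoint x y ∧ s = x ∪ y}
  isRelLowerSet_faces := by
    rintro _ ⟨hne, x, hx, y, hy, hd, rfl⟩
    refine ⟨hne, fun t ht htne => ⟨htne, t ∩ x, ?_, t ∩ y, ?_, ?_, ?_⟩⟩
    · exact augFaces_of_subset hx Finset.inter_subset_right
    · exact augFaces_of_subset hy Finset.inter_subset_right
    · exact hd.mono Finset.inter_subset_right Finset.inter_subset_right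
    · rw [← Finset.inter_union_distrib_left]
      exact (Finset.inter_eq_left.mpr ht).symm

/-- The link `lk(A, K)`. -/
def link (A : Finset ℕ) (K : Complex) : Complex where
  faces := {B | B.Nonempty ∧ Disjoint A B ∧ A ∪ B ∈ K.faces}
  isRelLowerSet_faces := fun _ hB => ⟨hB.1, fun _ ht hne =>
    ⟨hne, hB.2.1.mono_right ht,
      mem_of_subset hB.2.2 (Finset.union_subset_union_right ht)
        (hne.mono Finset.subset_union_right)⟩⟩

/-- The complex `Q(A, K)` of the simplexes of `K` that do not contain `A`. -/
def avoid (A : Finset ℕ) (K : Complex) : Complex where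
  faces := {s | s ∈ K.faces ∧ ¬ A ⊆ s}
  isRelLowerSet_faces := fun _ hs => ⟨nonempty_of_mem hs.1, fun _ ht hne =>
    ⟨mem_of_subset hs.1 ht hne, fun h => hs.2 (h.trans ht)⟩⟩

/-- The cone `a ⋆ K`. -/
def cone (a : ℕ) (K : Complex) : Complex := join (simplex {a}) K

/-- The starring `(A a)K = a ⋆ ∂A ⋆ lk(A, K) + Q(A, K)` of `K` at `a`. -/
def starring (A : Finset ℕ) (a : ℕ) (K : Complex) : Complex :=
  cone a (join (simplexBoundary A) (link A K)) ⊔ avoid A K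

/-- `L` arises from `K` by one stellar subdivision. -/
def IsSubdivision (K L : Complex) : Prop :=
  ∃ A ∈ K.faces, ∃ a : ℕ, a ∉ vertices K ∧ L = starring A a K

/-- `L` arises from `K` by a change of the enumeration of the vertices. -/
def IsRelabelling (K L : Complex) : Prop :=
  ∃ f : ℕ → ℕ, Set.InjOn f (vertices K) ∧ L = K.map f

/-- The stellar moves: subdivisions, welds (inverses of subdivisions), enumeration changes. -/
inductive Move (K L : Complex) : Prop
  | subdivision (h : IsSubdivision K L)
  | weld (h : IsSubdivision L K)
  | relabelling (h : IsRelabelling K L)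

/-- Stellar equivalence of simplicial complexes. -/
def StellarEquiv : Complex → Complex → Prop := Relation.ReflTransGen Move

/-- `K` is a stellar `(m-1)`-ball: it is equivalent to a simplex with `m` vertices. -/
def IsStellarBall (m : ℕ) (K : Complex) : Prop := StellarEquiv K (simplex (Finset.range m))

/-- `K` is a stellar `(m-1)`-sphere: it is equivalent to the boundary of a simplex with `m + 1`
vertices (for `m = 0` this is the empty complex). -/
def IsStellarSphere (m : ℕ) (K : Complex) : Prop :=
  StellarEquiv K (simplexBoundary (Finset.range (m + 1)))

/-- `M` is a stellar `n`-manifold: every vertex link is a stellar `(n-1)`-ball or a stellar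
`(n-1)`-sphere. -/
def IsStellarManifold (n : ℕ) (M : Complex) : Prop :=
  ∀ v ∈ vertices M, IsStellarBall n (link {v} M) ∨ IsStellarSphere n (link {v} M)

/-- The standard realization of `K`, in barycentric coordinates. -/
def realization (K : Complex) : Set (ℕ → ℝ) :=
  {x | (∀ i, 0 ≤ x i) ∧ ∃ s ∈ K.faces, (∀ i, i ∉ s → x i = 0) ∧ ∑ i ∈ s, x i = 1}

/-- The boundary `∂g` of a simplex, as a chain with coefficients in `ℤ/2`. -/
noncomputable def chainBoundary (g : Finset ℕ) : Finset ℕ →₀ ZMod 2 :=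
  ∑ v ∈ g, Finsupp.single (g.erase v) 1

/-- The `n`-dimensional complex `M` (with finitely many generators) is closed: the sum `∂M` of the
boundaries of its generators vanishes. -/
def IsClosedComplex (n : ℕ) (M : Complex) : Prop :=
  ∑ᶠ g ∈ generators (n + 1) M, chainBoundary g = 0

/-- A regular equivalence on an `(m-1)`-dimensional complex `S`: an equivalence relation on the
vertices and an equivalence relation on the generators such that no generator has two distinct
equivalent vertices, every generator is equivalent to at most one other generator, and every
vertex of a generator is equivalent to some vertex of each generator equivalent to it. -/
structure RegularEquivalence (m : ℕ) (S : Complex) where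
  vert : Setoid (vertices S)
  gen : Setoid (generators m S)
  vert_injective : ∀ g : generators m S, ∀ v w : vertices S,
    v.1 ∈ g.1 → w.1 ∈ g.1 → vert v w → v = w
  gen_unique : ∀ g p q : generators m S, p ≠ g → q ≠ g → gen g p → gen g q → p = q
  gen_vert : ∀ g p : generators m S, gen g p →
    ∀ v : vertices S, v.1 ∈ g.1 → ∃ w : vertices S, w.1 ∈ p.1 ∧ vert v w

/-- The elementary identifications of simplexes of `S` prescribed by a regular equivalence:
equivalent vertices are identified, and equivalent generators `g`, `p` are identified along the
vertex correspondence, so that a face `s` of `g` is identified with the face `t` of `p` that has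
equivalent vertices. -/
inductive RegularEquivalence.Glued {m : ℕ} {S : Complex} (R : RegularEquivalence m S) :
    Finset ℕ → Finset ℕ → Prop
  | vertex (v w : vertices S) (h : R.vert v w) : Glued R {v.1} {w.1}
  | face (g p : generators m S) (h : R.gen g p) (s t : Finset ℕ)
      (hs : s.Nonempty) (hsg : s ⊆ g.1) (htp : t ⊆ p.1)
      (hst : ∀ v : vertices S, v.1 ∈ s → ∃ w : vertices S, w.1 ∈ t ∧ R.vert v w)
      (hts : ∀ w : vertices S, w.1 ∈ t → ∃ v : vertices S, v.1 ∈ s ∧ R.vert v w) : Glued R s t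

/-- The simplexes of `a ⋆ S` (with the empty one), to be compared modulo the identifications of
simplexes of `S` that `R` prescribes. -/
def ConeCell (a : ℕ) {m : ℕ} {S : Complex} (_R : RegularEquivalence m S) : Type :=
  {s : Finset ℕ // s ∈ augFaces (cone a S)}

/-- `x ≤ y` when `y` is reached from `x` through inclusions of simplexes of `a ⋆ S` and
identifications of simplexes of `S`. -/
instance (a : ℕ) {m : ℕ} {S : Complex} (R : RegularEquivalence m S) :
    Preorder (ConeCell a R) where
  le := Relation.ReflTransGen fun x y => x.1 ⊆ y.1 ∨ R.Glued x.1 y.1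
  le_refl _ := Relation.ReflTransGen.refl
  le_trans _ _ _ := Relation.ReflTransGen.trans

/-- The structure `a ⋆ (S/≃)`, given by its simplexes ordered by the face relation: the quotient
of the set of simplexes of `a ⋆ S` by the identifications of simplexes of `S` (inclusions raise
the dimension and identifications keep it, so the antisymmetrization identifies exactly what the
identifications identify). Simplexes of `a ⋆ S` that contain `a` are never identified. -/
abbrev StellarStructure (a : ℕ) {m : ℕ} {S : Complex} (R : RegularEquivalence m S) : Type :=
  Antisymmetrization (ConeCell a R) (· ≤ ·)

/-- The simplexes of the complex `K` (with the empty one), ordered by inclusion. -/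
abbrev FacePoset (K : Complex) : Type := {s : Finset ℕ // s ∈ augFaces K}

/-- Generalized simplicial complexes, in which several simplexes may have the same vertices, given
by their simplexes ordered by the face relation: there is a least element (the empty simplex), and
the faces of each simplex form the lattice of subsets of a finite set. -/
def IsSimplicialPoset (P : PartOrd.{0}) : Prop :=
  (∃ b : P, IsBot b) ∧ ∀ x : P, ∃ k : ℕ, Nonempty (Set.Iic x ≃o Finset (Fin k))

/-- The starring of a generalized simplicial complex at its simplex `A`. The pair `(x, x)` is the
old simplex `x`, kept when it does not contain `A`. The pair `(x, z)` with `z` a smallest simplex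
containing both `x` and `A` is the new simplex `a ⋆ x` inside `z`, where `a` is the new vertex. -/
def PosetStarring (P : PartOrd.{0}) (A : P) : PartOrd.{0} :=
  PartOrd.of {q : P × P // ¬ A ≤ q.1 ∧ (q.2 = q.1 ∨ Minimal (fun z => q.1 ≤ z ∧ A ≤ z) q.2)}

/-- `Q` arises from `P` by one stellar subdivision (simplexes being named up to isomorphism). -/
def IsPosetSubdivision (P Q : PartOrd.{0}) : Prop :=
  ∃ A : P, ¬ IsBot A ∧ Nonempty (Q ≃o PosetStarring P A)

/-- The stellar moves between generalized simplicial complexes. -/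
inductive PosetMove (P Q : PartOrd.{0}) : Prop
  | subdivision (hP : IsSimplicialPoset P) (hQ : IsSimplicialPoset Q) (h : IsPosetSubdivision P Q)
  | weld (hP : IsSimplicialPoset P) (hQ : IsSimplicialPoset Q) (h : IsPosetSubdivision Q P)
  | relabelling (hP : IsSimplicialPoset P) (hQ : IsSimplicialPoset Q) (h : Nonempty (P ≃o Q))

/-- Stellar equivalence of generalized simplicial complexes. -/
def PosetStellarEquiv : PartOrd.{0} → PartOrd.{0} → Prop := Relation.ReflTransGen PosetMove

/-- The complex `M` admits the triangulation `a ⋆ (S/≃)`: they are stellar equivalent. -/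
def AdmitsStellarStructure (M : Complex) (a : ℕ) {m : ℕ} {S : Complex}
    (R : RegularEquivalence m S) : Prop :=
  PosetStellarEquiv (PartOrd.of (FacePoset M)) (PartOrd.of (StellarStructure a R))

end Stellar

namespace Stellar

/-! The manifold is unfolded along a spanning tree of its generators. The generators are lifted to
simplexes with fresh vertices, glued only along the facets that the tree crosses. The lifts form a
ball with boundary sphere `S`, and every vertex of `S` remembers through `label` the vertex of `M`
over which it lies. Removing from `M` the unfolded generators and the crossed facets `D`, and
attaching the cone `a ⋆ S` with its base folded by the labels, gives the generalized complex
`cellPoset M D S`. Once all generators are unfolded, what remains of `M` is the folded image of `S`,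
and this complex is `a ⋆ (S/≃)`, where equivalent means equally labelled.

The first generator is simply starred (`posetStellarEquiv_single`). Each further one costs two moves
(`Crossing.posetStellarEquiv`). Let an unfolded generator `G` and a new generator `p` share the
facet `f`, let `f'` be the lift of `f` in `S`, let `b` be the vertex of `p` opposite `f`, and let
`c` be a fresh vertex labelled `b`. The star of `f` is `f ⋆ {a, b}`, so starring `f` at `d` produces
`d ⋆ ∂f ⋆ {a, b}`. In the next complex `f'` has been replaced in the sphere by `c ⋆ ∂f'`, the cone
contains `a ⋆ c ⋆ ∂f'`, and starring the edge `ac` at `d` produces the same thing. Hence a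
subdivision followed by a weld leads from one to the other.

Of the manifold property only `IsNormal` is needed. It holds for simplexes and their boundaries, is
invariant under stellar moves, and passes from vertex links to `M`. That a facet lies in at most two
generators makes `f'` unique and the equivalence regular. That stars are connected through facets
shows that equally labelled simplexes of `S` are joined by a chain of identifications along facets
(`Unfolding.le_of_labels_eq`), and together with connectedness of the realization it provides the
tree (`exists_crossing_facet`). -/

/-! ### Simplexes of joins, links, cones and starrings. -/

theorem empty_mem_augFaces (K : Complex) : ∅ ∈ augFaces K := Or.inl rfl

theorem notMem_of_mem_augFaces {K : Complex} {a : ℕ} (ha : a ∉ vertices K) {s : Finset ℕ}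
    (hs : s ∈ augFaces K) : a ∉ s := by
  intro has
  rcases hs with rfl | hs
  · simp at has
  · exact ha (mem_of_subset hs (by simpa using has) (by simp))

theorem mem_augFaces_simplex {A s : Finset ℕ} : s ∈ augFaces (simplex A) ↔ s ⊆ A := by
  rcases s.eq_empty_or_nonempty with rfl | h
  · simp [augFaces]
  · simp [augFaces, simplex, h, h.ne_empty]

theorem mem_augFaces_simplexBoundary {A s : Finset ℕ} (hA : A.Nonempty) :
    s ∈ augFaces (simplexBoundary A) ↔ s ⊂ A := by
  rcases s.eq_empty_or_nonempty with rfl | h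
  · simp [augFaces, hA]
  · simp [augFaces, simplexBoundary, h, h.ne_empty]

theorem mem_augFaces_link {K : Complex} {A s : Finset ℕ} (hA : A ∈ K.faces) :
    s ∈ augFaces (link A K) ↔ Disjoint A s ∧ A ∪ s ∈ K.faces := by
  rcases s.eq_empty_or_nonempty with rfl | h
  · simp [augFaces, hA]
  · simp [augFaces, link, h, h.ne_empty]

theorem mem_augFaces_join {K L : Complex} {s : Finset ℕ} :
    s ∈ augFaces (join K L) ↔
      ∃ x ∈ augFaces K, ∃ y ∈ augFaces L, Disjoint x y ∧ s = x ∪ y := by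
  rcases s.eq_empty_or_nonempty with rfl | h
  · refine ⟨fun _ => ⟨∅, Or.inl rfl, ∅, Or.inl rfl, by simp, by simp⟩, fun _ => Or.inl rfl⟩
  · constructor
    · rintro (rfl | h')
      · simp at h
      · exact h'.2
    · exact fun h' => Or.inr ⟨h, h'⟩

theorem mem_augFaces_cone {K : Complex} {a : ℕ} (ha : a ∉ vertices K) {s : Finset ℕ} :
    s ∈ augFaces (cone a K) ↔ s.erase a ∈ augFaces K := by
  rw [cone, mem_augFaces_join]
  constructor
  · rintro ⟨x, hx, y, hy, -, rfl⟩
    rw [mem_augFaces_simplex] at hx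
    have := notMem_of_mem_augFaces ha hy
    have : (x ∪ y).erase a = y := by grind
    rwa [this]
  · intro h
    by_cases has : a ∈ s
    · exact ⟨{a}, by simp [mem_augFaces_simplex], s.erase a, h, by simp, by grind⟩
    · exact ⟨∅, Or.inl rfl, s.erase a, h, by simp, by grind⟩

theorem mem_augFaces_sup {K L : Complex} {s : Finset ℕ} :
    s ∈ augFaces (K ⊔ L) ↔ s ∈ augFaces K ∨ s ∈ augFaces L := by
  change (s = ∅ ∨ (s ∈ K.faces ∨ s ∈ L.faces)) ↔ (s = ∅ ∨ s ∈ K.faces) ∨ (s = ∅ ∨ s ∈ L.faces)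
  tauto

theorem mem_augFaces_avoid {K : Complex} {A s : Finset ℕ} (hA : A.Nonempty) :
    s ∈ augFaces (avoid A K) ↔ s ∈ augFaces K ∧ ¬ A ⊆ s := by
  rcases s.eq_empty_or_nonempty with rfl | h
  · simp [augFaces, hA.ne_empty]
  · simp [augFaces, avoid, h.ne_empty]

/-- The join `a ⋆ ∂A ⋆ lk(A, K)` reduces to one test: a simplex through `a` is admitted when trading
`a` for the whole of `A` gives a simplex of `K`. This is the form in which starrings are used below.
-/
theorem mem_augFaces_starring {K : Complex} {A : Finset ℕ} (hA : A ∈ K.faces) {a : ℕ}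
    (ha : a ∉ vertices K) {s : Finset ℕ} :
    s ∈ augFaces (starring A a K) ↔ ¬ A ⊆ s ∧
      ((a ∉ s ∧ s ∈ augFaces K) ∨ (a ∈ s ∧ s.erase a ∪ A ∈ augFaces K)) := by
  have hne := nonempty_of_mem hA
  have haA : a ∉ A := notMem_of_mem_augFaces ha (Or.inr hA)
  have hv : a ∉ vertices (join (simplexBoundary A) (link A K)) := by
    intro h
    have h' : {a} ∈ augFaces (join (simplexBoundary A) (link A K)) := Or.inr h
    obtain ⟨x, hx, y, hy, -, hxy⟩ := mem_augFaces_join.1 h'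
    rw [mem_augFaces_simplexBoundary hne] at hx
    rw [mem_augFaces_link hA] at hy
    have := notMem_of_mem_augFaces ha (Or.inr hy.2)
    have := hx.1
    have : a ∈ x ∪ y := by rw [← hxy]; simp
    grind
  rw [starring, mem_augFaces_sup, mem_augFaces_avoid hne, mem_augFaces_cone hv, mem_augFaces_join]
  constructor
  · rintro (⟨x, hx, y, hy, hd, hs⟩ | ⟨h1, h2⟩)
    · rw [mem_augFaces_simplexBoundary hne] at hx
      rw [mem_augFaces_link hA] at hy
      obtain ⟨v, hvA, hvx⟩ := Finset.exists_of_ssubset hx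
      have hx1 := hx.1
      have hAs : ¬ A ⊆ s := by
        intro h
        have : v ∈ s.erase a := by
          have := h hvA
          simp only [Finset.mem_erase]
          exact ⟨fun h => haA (h ▸ hvA), this⟩
        rw [hs] at this
        have := Finset.disjoint_left.1 hy.1 hvA
        grind
      refine ⟨hAs, ?_⟩
      by_cases has : a ∈ s
      · refine Or.inr ⟨has, ?_⟩
        rw [hs]
        have : x ∪ y ∪ A = A ∪ y := by grind
        rw [this]
        exact Or.inr hy.2
      · refine Or.inl ⟨has, ?_⟩
        rw [Finset.erase_eq_of_notMem has] at hs
        exact augFaces_of_subset (Or.inr hy.2) (by grind)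
    · exact ⟨h2, Or.inl ⟨notMem_of_mem_augFaces ha h1, h1⟩⟩
  · rintro ⟨hAs, ⟨has, hs⟩ | ⟨has, hs⟩⟩
    · exact Or.inr ⟨hs, hAs⟩
    · refine Or.inl ⟨s ∩ A, ?_, s.erase a \ A, ?_, ?_, ?_⟩
      · rw [mem_augFaces_simplexBoundary hne]
        exact ⟨Finset.inter_subset_right, fun h => hAs fun x hx => (Finset.mem_inter.1 (h hx)).1⟩
      · rw [mem_augFaces_link hA]
        have h1 : A ∪ s.erase a \ A = s.erase a ∪ A := by grind
        refine ⟨Finset.disjoint_sdiff, ?_⟩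
        rw [h1]
        rcases hs with hs | hs
        · rw [Finset.union_eq_empty] at hs
          exact absurd hs.2 hne.ne_empty
        · exact hs
      · exact Finset.disjoint_sdiff.mono_left Finset.inter_subset_right
      · grind

/-! ### Normal pseudomanifolds. -/

/-- The simplexes of `F` with `m` vertices that contain `B`. -/
def gensOver (m : ℕ) (F : Set (Finset ℕ)) (B : Finset ℕ) : Set (Finset ℕ) :=
  {G | G ∈ F ∧ B ⊆ G ∧ G.card = m}

/-- Two simplexes of `F` with `m` vertices that contain `B` and share at least `m - 1` vertices. -/
def AdjOver (m : ℕ) (F : Set (Finset ℕ)) (B G H : Finset ℕ) : Prop :=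
  G ∈ gensOver m F B ∧ H ∈ gensOver m F B ∧ m ≤ (G ∩ H).card + 1

/-- The family of simplexes `F` is that of a normal pseudomanifold whose generators have `m`
vertices: it is pure, a simplex with `m - 1` vertices lies in at most two generators, and the
generators that contain a given simplex are connected through common simplexes with `m - 1`
vertices. -/
structure IsNormal (m : ℕ) (F : Set (Finset ℕ)) : Prop where
  dim : ∀ s ∈ F, s.card ≤ m
  pure : ∀ s ∈ F, (gensOver m F s).Nonempty
  two : ∀ f ∈ F, f.card + 1 = m → ∀ G ∈ gensOver m F f, ∀ H ∈ gensOver m F f,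
    ∀ I ∈ gensOver m F f, G = H ∨ G = I ∨ H = I
  conn : ∀ B ∈ F, ∀ G ∈ gensOver m F B, ∀ H ∈ gensOver m F B,
    Relation.ReflTransGen (AdjOver m F B) G H

theorem isNormal_simplex (m : ℕ) : IsNormal m (augFaces (simplex (Finset.range m))) := by
  have key : ∀ B, ∀ G ∈ gensOver m (augFaces (simplex (Finset.range m))) B,
      G = Finset.range m := by
    rintro B G ⟨hG, -, hc⟩
    rw [mem_augFaces_simplex] at hG
    exact Finset.eq_of_subset_of_card_le hG (by simp [hc])
  refine ⟨fun s hs => ?_, fun s hs => ?_, fun f _ _ G hG H hH _ _ => ?_, fun B _ G hG H hH => ?_⟩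
  · rw [mem_augFaces_simplex] at hs
    simpa using Finset.card_le_card hs
  · rw [mem_augFaces_simplex] at hs
    exact ⟨Finset.range m, by simp [gensOver, mem_augFaces_simplex, hs]⟩
  · exact Or.inl ((key _ _ hG).trans (key _ _ hH).symm)
  · rw [key _ _ hG, key _ _ hH]

/-- A generator omits exactly one vertex. Hence any two generators are adjacent, and a simplex with
`m - 1` vertices, which omits two, lies in no third generator. -/
theorem isNormal_simplexBoundary (m : ℕ) :
    IsNormal m (augFaces (simplexBoundary (Finset.range (m + 1)))) := by
  have hne : (Finset.range (m + 1)).Nonempty := by simp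
  have hm : ∀ {s}, s ∈ augFaces (simplexBoundary (Finset.range (m + 1))) ↔
    s ⊂ Finset.range (m + 1) := mem_augFaces_simplexBoundary hne
  have key : ∀ B, ∀ G ∈ gensOver m (augFaces (simplexBoundary (Finset.range (m + 1)))) B,
      ∃ v ∈ Finset.range (m + 1), v ∉ B ∧ G = (Finset.range (m + 1)).erase v := by
    rintro B G ⟨hG, hB, hc⟩
    rw [hm] at hG
    obtain ⟨v, hv, hvG⟩ := Finset.exists_of_ssubset hG
    refine ⟨v, hv, fun h => hvG (hB h), Finset.eq_of_subset_of_card_le ?_ ?_⟩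
    · have := hG.1
      grind
    · rw [Finset.card_erase_of_mem hv]; simp [hc]
  refine ⟨fun s hs => ?_, fun s hs => ?_, fun f hf hfc G hG H hH I hI => ?_,
    fun B _ G hG H hH => ?_⟩
  · rw [hm] at hs
    have := Finset.card_lt_card hs
    simp at this
    omega
  · rw [hm] at hs
    obtain ⟨v, hv, hvs⟩ := Finset.exists_of_ssubset hs
    have := hs.1
    exact ⟨(Finset.range (m + 1)).erase v, hm.2 (Finset.erase_ssubset hv), by grind,
      by rw [Finset.card_erase_of_mem hv]; simp⟩
  · obtain ⟨u, hu, huf, rfl⟩ := key _ _ hG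
    obtain ⟨v, hv, hvf, rfl⟩ := key _ _ hH
    obtain ⟨w, hw, hwf, rfl⟩ := key _ _ hI
    rw [hm] at hf
    have h2 : (Finset.range (m + 1) \ f).card = 2 := by
      rw [Finset.card_sdiff_of_subset hf.1]; simp; omega
    by_contra! hcon
    have hsub : ({u, v, w} : Finset ℕ) ⊆ Finset.range (m + 1) \ f := by
      intro x; simp only [Finset.mem_insert, Finset.mem_singleton]; rintro (rfl | rfl | rfl) <;> grind
    have := Finset.card_le_card hsub
    have h3 : ({u, v, w} : Finset ℕ).card = 3 := by
      rw [Finset.card_eq_three]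
      exact ⟨u, v, w, by rintro rfl; simp at hcon, by rintro rfl; simp at hcon,
        by rintro rfl; simp at hcon, rfl⟩
    omega
  · refine Relation.ReflTransGen.single ⟨hG, hH, ?_⟩
    obtain ⟨u, hu, -, rfl⟩ := key _ _ hG
    obtain ⟨v, hv, -, rfl⟩ := key _ _ hH
    have : (Finset.range (m + 1)).erase u ∩ (Finset.range (m + 1)).erase v
      = ((Finset.range (m + 1)).erase u).erase v := by grind
    rw [this]
    have h1 := Finset.pred_card_le_card_erase (s := (Finset.range (m + 1)).erase u) (a := v)
    rw [Finset.card_erase_of_mem hu] at h1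
    simp at h1
    omega

/-- Normality is pulled back along injective relabellings. -/
theorem IsNormal.of_map {m : ℕ} {K : Complex} {f : ℕ → ℕ} (hf : Set.InjOn f (vertices K))
    (h : IsNormal m (augFaces (K.map f))) : IsNormal m (augFaces K) := by
  have hmem : ∀ {t}, t ∈ augFaces (K.map f) ↔ ∃ s ∈ augFaces K, s.image f = t := by
    intro t
    constructor
    · rintro (rfl | ⟨s, hs, rfl⟩)
      · exact ⟨∅, Or.inl rfl, rfl⟩
      · exact ⟨s, Or.inr hs, rfl⟩
    · rintro ⟨s, rfl | hs, rfl⟩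
      · exact Or.inl rfl
      · exact Or.inr ⟨s, hs, rfl⟩
  have hvert : ∀ {s}, s ∈ augFaces K → ∀ x ∈ s, x ∈ vertices K := fun hs x hx => by
    by_contra hc
    exact notMem_of_mem_augFaces hc hs hx
  have hcard : ∀ {s}, s ∈ augFaces K → (s.image f).card = s.card := fun hs =>
    Finset.card_image_of_injOn fun x hx y hy hxy => hf (hvert hs x hx) (hvert hs y hy) hxy
  have hsub : ∀ {s t}, s ∈ augFaces K → t ∈ augFaces K → s.image f ⊆ t.image f → s ⊆ t := by
    intro s t hs ht hst x hx
    obtain ⟨y, hy, hxy⟩ := Finset.mem_image.1 (hst (Finset.mem_image_of_mem f hx))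
    rwa [← hf (hvert ht y hy) (hvert hs x hx) hxy]
  have hinj : ∀ {s t}, s ∈ augFaces K → t ∈ augFaces K → s.image f = t.image f → s = t :=
    fun hs ht h => (hsub hs ht h.le).antisymm (hsub ht hs h.ge)
  have hgen : ∀ {B G}, B ∈ augFaces K → G ∈ augFaces K →
      (G ∈ gensOver m (augFaces K) B ↔ G.image f ∈ gensOver m (augFaces (K.map f)) (B.image f)) :=
    fun hB hG => ⟨fun h => ⟨hmem.2 ⟨_, hG, rfl⟩, Finset.image_subset_image h.2.1,
      (hcard hG).trans h.2.2⟩, fun h => ⟨hG, hsub hB hG h.2.1, (hcard hG).symm.trans h.2.2⟩⟩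
  refine ⟨fun s hs => ?_, fun s hs => ?_, fun e he hec G hG H hH I hI => ?_,
    fun B hB G hG H hH => ?_⟩
  · rw [← hcard hs]
    exact h.dim _ (hmem.2 ⟨s, hs, rfl⟩)
  · obtain ⟨G', hG'⟩ := h.pure _ (hmem.2 ⟨s, hs, rfl⟩)
    obtain ⟨G, hG, rfl⟩ := hmem.1 hG'.1
    exact ⟨G, (hgen hs hG).2 hG'⟩
  · have := h.two _ (hmem.2 ⟨e, he, rfl⟩) (by rw [hcard he, hec]) _ ((hgen he hG.1).1 hG)
      _ ((hgen he hH.1).1 hH) _ ((hgen he hI.1).1 hI)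
    exact this.imp (hinj hG.1 hH.1) (Or.imp (hinj hG.1 hI.1) (hinj hH.1 hI.1))
  · have hc := h.conn _ (hmem.2 ⟨B, hB, rfl⟩) _ ((hgen hB hG.1).1 hG) _ ((hgen hB hH.1).1 hH)
    have : ∀ H', Relation.ReflTransGen (AdjOver m (augFaces (K.map f)) (B.image f)) (G.image f) H' →
        ∀ H ∈ augFaces K, H.image f = H' → Relation.ReflTransGen (AdjOver m (augFaces K) B) G H := by
      intro H' hH'
      induction hH' with
      | refl => intro H hH e; rw [hinj hH hG.1 e]
      | @tail X Y _ hXY ih =>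
        intro H hH e
        obtain ⟨X, hX, rfl⟩ := hmem.1 hXY.1.1
        subst e
        refine (ih X hX rfl).tail ⟨(hgen hB hX).2 hXY.1, (hgen hB hH).2 hXY.2.1, ?_⟩
        have h1 : X.image f ∩ H.image f = (X ∩ H).image f := by
          rw [Finset.image_inter_of_injOn]
          rintro x hx y hy hxy
          refine hf ?_ ?_ hxy
          · rcases hx with hx | hx
            exacts [hvert hX x hx, hvert hH x hx]
          · rcases hy with hx | hx
            exacts [hvert hX y hx, hvert hH y hx]
        have h2 := hXY.2.2
        rw [h1] at h2
        exact h2.trans (Nat.succ_le_succ Finset.card_image_le)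
    exact this _ hc H hH.1 rfl

/-! ### Normality is invariant under starrings and welds. -/

/-- The simplex of the original complex that carries the simplex `s` of the starring of `A`
at `a`. -/
def carrier (A : Finset ℕ) (a : ℕ) (s : Finset ℕ) : Finset ℕ :=
  if a ∈ s then s.erase a ∪ A else s

/-- `F'` is obtained from the family of simplexes `F` by starring `A` at the new vertex `a`. -/
structure StarringFamily (A : Finset ℕ) (a : ℕ) (F F' : Set (Finset ℕ)) : Prop where
  lower : ∀ s ∈ F, ∀ t ⊆ s, t ∈ F
  mem : A ∈ F
  fresh : ∀ s ∈ F, a ∉ s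
  mem_iff : ∀ s, s ∈ F' ↔ ¬ A ⊆ s ∧ ((a ∉ s ∧ s ∈ F) ∨ (a ∈ s ∧ s.erase a ∪ A ∈ F))

theorem starringFamily {K : Complex} {A : Finset ℕ} (hA : A ∈ K.faces) {a : ℕ}
    (ha : a ∉ vertices K) : StarringFamily A a (augFaces K) (augFaces (starring A a K)) where
  lower _ hs _ ht := augFaces_of_subset hs ht
  mem := Or.inr hA
  fresh _ hs := notMem_of_mem_augFaces ha hs
  mem_iff _ := mem_augFaces_starring hA ha

theorem carrier_of_notMem {A : Finset ℕ} {a : ℕ} {s : Finset ℕ} (h : a ∉ s) :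
    carrier A a s = s := by simp [carrier, h]

theorem carrier_of_mem {A : Finset ℕ} {a : ℕ} {s : Finset ℕ} (h : a ∈ s) :
    carrier A a s = s.erase a ∪ A := by simp [carrier, h]

theorem carrier_mono {A : Finset ℕ} {a : ℕ} {s t : Finset ℕ} (h : s ⊆ t) :
    carrier A a s ⊆ carrier A a t := by
  unfold carrier
  split_ifs <;> grind

theorem exists_eq_insert_of_card {s t : Finset ℕ} (h : s ⊆ t) (hc : s.card + 1 = t.card) :
    ∃ w, w ∉ s ∧ t = insert w s := by
  have h1 : (t \ s).card = 1 := by rw [Finset.card_sdiff_of_subset h]; omega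
  obtain ⟨w, hw⟩ := Finset.card_eq_one.1 h1
  have h2 : w ∈ t \ s := by rw [hw]; simp
  refine ⟨w, (Finset.mem_sdiff.1 h2).2, ?_⟩
  rw [← Finset.sdiff_union_of_subset h, hw]
  rfl

namespace StarringFamily

variable {A : Finset ℕ} {a : ℕ} {F F' : Set (Finset ℕ)} {m : ℕ}

theorem notMem (h : StarringFamily A a F F') : a ∉ A := h.fresh A h.mem

theorem carrier_mem (h : StarringFamily A a F F') {s : Finset ℕ} (hs : s ∈ F') :
    carrier A a s ∈ F := by
  rcases ((h.mem_iff s).1 hs).2 with ⟨h1, h2⟩ | ⟨h1, h2⟩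
  · rwa [carrier_of_notMem h1]
  · rwa [carrier_of_mem h1]

theorem not_subset (h : StarringFamily A a F F') {s : Finset ℕ} (hs : s ∈ F') : ¬ A ⊆ s :=
  ((h.mem_iff s).1 hs).1

/-- A vertex of `A` missing from `s` takes the place of `a` in the carrier. -/
theorem card_le_carrier (h : StarringFamily A a F F') {s : Finset ℕ} (hs : s ∈ F') :
    s.card ≤ (carrier A a s).card := by
  by_cases ha : a ∈ s
  · rw [carrier_of_mem ha]
    obtain ⟨w, hwA, hws⟩ := Finset.not_subset.1 (h.not_subset hs)
    calc s.card = (insert w (s.erase a)).card := by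
          rw [Finset.card_insert_of_notMem (by grind), Finset.card_erase_add_one ha]
      _ ≤ _ := Finset.card_le_card (by grind)
  · rw [carrier_of_notMem ha]

/-- Starring cuts a simplex through `A` into pieces in which one vertex of `A` is traded for `a`.
These pieces give sections of `carrier` that preserve the number of vertices. -/
theorem insert_erase_mem (h : StarringFamily A a F F') {H : Finset ℕ} (hH : H ∈ F) (hA : A ⊆ H)
    {v : ℕ} (hv : v ∈ A) : insert a (H.erase v) ∈ F' ∧
      (insert a (H.erase v)).card = H.card ∧ carrier A a (insert a (H.erase v)) = H := by
  have ha := h.fresh H hH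
  have h1 : (insert a (H.erase v)).erase a = H.erase v := by grind
  have h2 : H.erase v ∪ A = H := by grind
  have haA := h.notMem
  refine ⟨(h.mem_iff _).2 ⟨by grind, Or.inr ⟨by simp, ?_⟩⟩, ?_, ?_⟩
  · rwa [h1, h2]
  · rw [Finset.card_insert_of_notMem (by grind), Finset.card_erase_add_one (hA hv)]
  · rw [carrier_of_mem (by simp), h1, h2]

theorem mem_of_not_subset (h : StarringFamily A a F F') {s : Finset ℕ} (hs : s ∈ F)
    (hA : ¬ A ⊆ s) : s ∈ F' ∧ carrier A a s = s :=
  ⟨(h.mem_iff s).2 ⟨hA, Or.inl ⟨h.fresh s hs, hs⟩⟩, carrier_of_notMem (h.fresh s hs)⟩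

theorem carrier_mem_gensOver (h : StarringFamily A a F F') (hd : ∀ s ∈ F, s.card ≤ m)
    {B G : Finset ℕ} (hG : G ∈ gensOver m F' B) :
    carrier A a G ∈ gensOver m F (carrier A a B) :=
  ⟨h.carrier_mem hG.1, carrier_mono hG.2.1, (hd _ (h.carrier_mem hG.1)).antisymm
    (hG.2.2.ge.trans (h.card_le_carrier hG.1))⟩

theorem insert_erase_mem_gensOver (h : StarringFamily A a F F') {B X : Finset ℕ}
    (hX : X ∈ gensOver m F (carrier A a B)) (hA : A ⊆ X) {v : ℕ} (hvA : v ∈ A) (hvB : v ∉ B) :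
    insert a (X.erase v) ∈ gensOver m F' B := by
  obtain ⟨h1, h2, -⟩ := h.insert_erase_mem hX.1 hA hvA
  refine ⟨h1, ?_, h2.trans hX.2.2⟩
  have := hX.2.1
  unfold carrier at this
  split_ifs at this <;> grind

theorem mem_gensOver_of_not_subset (h : StarringFamily A a F F') {B X : Finset ℕ}
    (hX : X ∈ gensOver m F (carrier A a B)) (hA : ¬ A ⊆ X) : X ∈ gensOver m F' B := by
  have haB : a ∉ B := by
    intro ha
    have := hX.2.1
    rw [carrier_of_mem ha] at this
    exact hA (Finset.union_subset_right this)
  exact ⟨(h.mem_of_not_subset hX.1 hA).1, carrier_of_notMem (A := A) haB ▸ hX.2.1, hX.2.2⟩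

/-- Generators over the carrier of `B` lift to generators over `B`. -/
theorem exists_lift (h : StarringFamily A a F F') {B X : Finset ℕ} (hB : B ∈ F')
    (hX : X ∈ gensOver m F (carrier A a B)) :
    ∃ Y ∈ gensOver m F' B, carrier A a Y = X := by
  by_cases hA : A ⊆ X
  · obtain ⟨v, hvA, hvB⟩ := Finset.not_subset.1 (h.not_subset hB)
    exact ⟨_, h.insert_erase_mem_gensOver hX hA hvA hvB, (h.insert_erase_mem hX.1 hA hvA).2.2⟩
  · exact ⟨X, h.mem_gensOver_of_not_subset hX hA, (h.mem_of_not_subset hX.1 hA).2⟩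

/-- Adjacent generators over the carrier of `B` have adjacent lifts over `B`. -/
theorem exists_adj_lift (h : StarringFamily A a F F') {B X Y : Finset ℕ} (hB : B ∈ F')
    (hXY : AdjOver m F (carrier A a B) X Y) :
    ∃ X' Y', AdjOver m F' B X' Y' ∧ carrier A a X' = X ∧ carrier A a Y' = Y := by
  obtain ⟨hX, hY, hc⟩ := hXY
  have haX := h.fresh X hX.1
  have haY := h.fresh Y hY.1
  by_cases hAX : A ⊆ X <;> by_cases hAY : A ⊆ Y
  · obtain ⟨v, hvA, hvB⟩ := Finset.not_subset.1 (h.not_subset hB)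
    refine ⟨_, _, ⟨h.insert_erase_mem_gensOver hX hAX hvA hvB,
      h.insert_erase_mem_gensOver hY hAY hvA hvB, ?_⟩,
      (h.insert_erase_mem hX.1 hAX hvA).2.2, (h.insert_erase_mem hY.1 hAY hvA).2.2⟩
    have h1 : insert a (X.erase v) ∩ insert a (Y.erase v) = insert a ((X ∩ Y).erase v) := by grind
    rw [h1, Finset.card_insert_of_notMem (by grind), Finset.card_erase_add_one (by grind)]
    exact hc
  · obtain ⟨w, hwA, hwY⟩ := Finset.not_subset.1 hAY
    have hY' := h.mem_gensOver_of_not_subset hY hAY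
    refine ⟨_, Y, ⟨h.insert_erase_mem_gensOver hX hAX hwA (fun hw => hwY (hY'.2.1 hw)), hY', ?_⟩,
      (h.insert_erase_mem hX.1 hAX hwA).2.2, (h.mem_of_not_subset hY.1 hAY).2⟩
    exact hc.trans (Nat.succ_le_succ (Finset.card_le_card (by grind)))
  · obtain ⟨w, hwA, hwX⟩ := Finset.not_subset.1 hAX
    have hX' := h.mem_gensOver_of_not_subset hX hAX
    refine ⟨X, _, ⟨hX', h.insert_erase_mem_gensOver hY hAY hwA (fun hw => hwX (hX'.2.1 hw)), ?_⟩,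
      (h.mem_of_not_subset hX.1 hAX).2, (h.insert_erase_mem hY.1 hAY hwA).2.2⟩
    exact hc.trans (Nat.succ_le_succ (Finset.card_le_card (by grind)))
  · exact ⟨X, Y, ⟨h.mem_gensOver_of_not_subset hX hAX, h.mem_gensOver_of_not_subset hY hAY, hc⟩,
      (h.mem_of_not_subset hX.1 hAX).2, (h.mem_of_not_subset hY.1 hAY).2⟩

/-- Generators with the same carrier are adjacent. -/
theorem adjOver_of_carrier_eq (h : StarringFamily A a F F') (hd : ∀ s ∈ F, s.card ≤ m)
    {B X Y : Finset ℕ} (hX : X ∈ gensOver m F' B) (hY : Y ∈ gensOver m F' B)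
    (hXY : carrier A a X = carrier A a Y) : AdjOver m F' B X Y := by
  refine ⟨hX, hY, ?_⟩
  have hAX := h.not_subset hX.1
  have hAY := h.not_subset hY.1
  have hcX := (h.carrier_mem_gensOver hd hX).2.2
  have hX2 := hX.2.2
  have hY2 := hY.2.2
  by_cases haX : a ∈ X <;> by_cases haY : a ∈ Y
  · rw [carrier_of_mem haX] at hXY hcX
    rw [carrier_of_mem haY] at hXY
    -- Without `a`, both are sets of `m - 1` vertices inside the common carrier of `m` vertices, so
    -- they share at least `m - 2`; the vertex `a` adds one more.
    have h1 : X ∩ Y = insert a (X.erase a ∩ Y.erase a) := by grind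
    have h2 := Finset.card_union_add_card_inter (X.erase a) (Y.erase a)
    have h3 : (X.erase a ∪ Y.erase a).card ≤ m := by
      rw [← hcX]
      refine Finset.card_le_card (Finset.union_subset Finset.subset_union_left ?_)
      rw [hXY]
      exact Finset.subset_union_left
    have h4 := Finset.card_erase_add_one haX
    have h5 := Finset.card_erase_add_one haY
    rw [h1, Finset.card_insert_of_notMem (by simp)]
    omega
  · rw [carrier_of_mem haX, carrier_of_notMem haY] at hXY
    exact absurd (hXY ▸ Finset.subset_union_right) hAY
  · rw [carrier_of_mem haY, carrier_of_notMem haX] at hXY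
    exact absurd (hXY ▸ Finset.subset_union_right) hAX
  · rw [carrier_of_notMem haX, carrier_of_notMem haY] at hXY
    subst hXY
    simp [hX2]

theorem carrier_adj (h : StarringFamily A a F F') (hd : ∀ s ∈ F, s.card ≤ m)
    {B X Y : Finset ℕ} (hXY : AdjOver m F' B X Y) :
    AdjOver m F (carrier A a B) (carrier A a X) (carrier A a Y) := by
  obtain ⟨hX, hY, hc⟩ := hXY
  refine ⟨h.carrier_mem_gensOver hd hX, h.carrier_mem_gensOver hd hY, hc.trans ?_⟩
  refine Nat.succ_le_succ ?_
  by_cases ha : a ∈ X ∩ Y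
  · obtain ⟨w, hwA, hwX⟩ := Finset.not_subset.1 (h.not_subset hX.1)
    rw [Finset.mem_inter] at ha
    rw [carrier_of_mem ha.1, carrier_of_mem ha.2]
    -- The vertex `w` of `A` lies in both carriers but not in `X`, so it makes up for the loss of
    -- `a`.
    calc (X ∩ Y).card = (insert w ((X ∩ Y).erase a)).card := by
          rw [Finset.card_insert_of_notMem (by grind), Finset.card_erase_add_one (by grind)]
      _ ≤ _ := Finset.card_le_card (by grind)
  · refine Finset.card_le_card ?_
    unfold carrier
    split_ifs <;> grind

/-- Everything is compared through `carrier`: adjacent generators downstairs have adjacent lifts,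
and generators with a common carrier are adjacent. For a facet `f` there are two cases. If its
carrier is a facet, `carrier` is injective on the generators over `f`; otherwise `f` lies inside a
single old generator. -/
theorem isNormal (h : StarringFamily A a F F') (hF : IsNormal m F) : IsNormal m F' where
  dim s hs := (h.card_le_carrier hs).trans (hF.dim _ (h.carrier_mem hs))
  pure s hs := by
    obtain ⟨G, hG⟩ := hF.pure _ (h.carrier_mem hs)
    obtain ⟨Y, hY, -⟩ := h.exists_lift hs hG
    exact ⟨Y, hY⟩
  two f hf hfc G hG H hH I hI := by
    have hgen : ∀ G ∈ gensOver m F' f, carrier A a G ∈ gensOver m F (carrier A a f) :=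
      fun G hG => h.carrier_mem_gensOver hF.dim hG
    have hins : ∀ G ∈ gensOver m F' f, ∃ w, w ∉ f ∧ G = insert w f := fun G hG =>
      exists_eq_insert_of_card hG.2.1 (hfc.trans hG.2.2.symm)
    by_cases hm : (carrier A a f).card + 1 = m
    · have hinj : ∀ G ∈ gensOver m F' f, ∀ H ∈ gensOver m F' f,
          carrier A a G = carrier A a H → G = H := by
        intro G hG H hH hGH
        have hG' := (hgen G hG).2.2
        obtain ⟨v, hv, rfl⟩ := hins G hG
        obtain ⟨w, hw, rfl⟩ := hins H hH
        by_cases haf : a ∈ f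
        · rw [carrier_of_mem haf] at hm
          rw [carrier_of_mem (by simp [haf])] at hGH hG'
          rw [carrier_of_mem (by simp [haf])] at hGH
          have h1 : (insert v f).erase a ∪ A = insert v (f.erase a ∪ A) := by grind
          have h2 : (insert w f).erase a ∪ A = insert w (f.erase a ∪ A) := by grind
          rw [h1] at hGH hG'
          rw [h2] at hGH
          have h3 : v ∉ f.erase a ∪ A := by
            intro h4
            rw [Finset.insert_eq_of_mem h4] at hG'
            omega
          have h4 : v ∈ insert w (f.erase a ∪ A) := by rw [← hGH]; simp
          have h5 : v = w := by grind
          rw [h5]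
        · have h1 := h.not_subset hG.1
          have h2 := h.not_subset hH.1
          by_cases hva : a = v <;> by_cases hwa : a = w
          · rw [← hva, ← hwa]
          · rw [carrier_of_mem (by simp [hva]), carrier_of_notMem (by simp [hwa, haf])] at hGH
            exact absurd (hGH ▸ Finset.subset_union_right) h2
          · rw [carrier_of_notMem (by simp [hva, haf]), carrier_of_mem (by simp [hwa])] at hGH
            exact absurd (hGH ▸ Finset.subset_union_right) h1
          · rwa [carrier_of_notMem (by simp [hva, haf]), carrier_of_notMem (by simp [hwa, haf])]
              at hGH
      exact (hF.two _ (h.carrier_mem hf) hm _ (hgen G hG) _ (hgen H hH) _ (hgen I hI)).imp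
        (hinj G hG H hH) (Or.imp (hinj G hG I hI) (hinj H hH I hI))
    -- Now the carrier of `f` has `m` vertices and is the carrier of all generators over `f`. Each
    -- of them adds to `f` a vertex of the carrier outside `f.erase a`, and there are only two such
    -- vertices.
    · have h1 := h.card_le_carrier hf
      have h2 := Finset.card_le_card (hgen G hG).2.1
      rw [(hgen G hG).2.2] at h2
      have h3 : (carrier A a f).card = m := by omega
      have haf : a ∈ f := by
        by_contra haf
        rw [carrier_of_notMem haf] at h3
        omega
      rw [carrier_of_mem haf] at h3
      have hw : ∀ G ∈ gensOver m F' f, ∃ w ∈ (f.erase a ∪ A) \ f.erase a, G = insert w f := by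
        intro G hG
        obtain ⟨w, hw, rfl⟩ := hins G hG
        refine ⟨w, ?_, rfl⟩
        have h4 := hgen _ hG
        have h5 := Finset.eq_of_subset_of_card_le h4.2.1
          (by rw [h4.2.2, carrier_of_mem haf, h3])
        rw [carrier_of_mem haf, carrier_of_mem (by simp [haf])] at h5
        rw [h5]
        grind
      obtain ⟨u, hu, rfl⟩ := hw G hG
      obtain ⟨v, hv, rfl⟩ := hw H hH
      obtain ⟨w, hw, rfl⟩ := hw I hI
      have h4 : ((f.erase a ∪ A) \ f.erase a).card = 2 := by
        rw [Finset.card_sdiff_of_subset Finset.subset_union_left, h3, Finset.card_erase_of_mem haf]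
        have := Finset.card_pos.2 ⟨a, haf⟩
        omega
      by_contra! hcon
      have h5 : ({u, v, w} : Finset ℕ) ⊆ (f.erase a ∪ A) \ f.erase a := by
        intro x; simp only [Finset.mem_insert, Finset.mem_singleton]
        rintro (rfl | rfl | rfl) <;> assumption
      have h6 := Finset.card_le_card h5
      have h7 : ({u, v, w} : Finset ℕ).card = 3 := by
        rw [Finset.card_eq_three]
        exact ⟨u, v, w, by rintro rfl; simp at hcon, by rintro rfl; simp at hcon,
          by rintro rfl; simp at hcon, rfl⟩
      omega
  conn B hB G hG H hH := by
    -- The chain of carriers is lifted edge by edge; the endpoints of consecutive lifted edges have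
    -- the same carrier and are therefore adjacent.
    have key : ∀ Y, Relation.ReflTransGen (AdjOver m F (carrier A a B)) (carrier A a G) Y →
        ∀ Y' ∈ gensOver m F' B, carrier A a Y' = Y →
          Relation.ReflTransGen (AdjOver m F' B) G Y' := by
      intro Y hY
      induction hY with
      | refl =>
        intro Y' hY' e
        exact Relation.ReflTransGen.single (h.adjOver_of_carrier_eq hF.dim hG hY' e.symm)
      | tail _ hXY ih =>
        intro Y' hY' e
        obtain ⟨X₁, Y₁, hadj, hX₁, hY₁⟩ := h.exists_adj_lift hB hXY
        exact ((ih X₁ hadj.1 hX₁).tail hadj).tail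
          (h.adjOver_of_carrier_eq hF.dim hadj.2.1 hY' (hY₁.trans e.symm))
    exact key _ (hF.conn _ (h.carrier_mem hB) _ (h.carrier_mem_gensOver hF.dim hG) _
      (h.carrier_mem_gensOver hF.dim hH)) H hH rfl

theorem exists_carrier_eq (h : StarringFamily A a F F') (hne : A.Nonempty) {s : Finset ℕ}
    (hs : s ∈ F) : ∃ t ∈ F', carrier A a t = s ∧ t.card = s.card := by
  by_cases hA : A ⊆ s
  · obtain ⟨v, hv⟩ := hne
    obtain ⟨h1, h2, h3⟩ := h.insert_erase_mem hs hA hv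
    exact ⟨_, h1, h3, h2⟩
  · exact ⟨s, (h.mem_of_not_subset hs hA).1, (h.mem_of_not_subset hs hA).2, rfl⟩

/-- Generators over a facet are lifted injectively to the starring, which bounds their number;
chains of generators in the starring are pushed down by `carrier`. -/
theorem isNormal_of_starring (h : StarringFamily A a F F') (hne : A.Nonempty)
    (hF : IsNormal m F') : IsNormal m F := by
  have hd : ∀ s ∈ F, s.card ≤ m := by
    intro s hs
    obtain ⟨t, ht, -, htc⟩ := h.exists_carrier_eq hne hs
    exact htc ▸ hF.dim t ht
  refine ⟨hd, fun s hs => ?_, fun f hf hfc G hG H hH I hI => ?_, fun B hB G hG H hH => ?_⟩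
  · obtain ⟨t, ht, rfl, -⟩ := h.exists_carrier_eq hne hs
    obtain ⟨G, hG⟩ := hF.pure t ht
    exact ⟨_, h.carrier_mem_gensOver hd hG⟩
  · by_cases hA : A ⊆ f
    · obtain ⟨v, hv⟩ := hne
      obtain ⟨h1, h2, h3⟩ := h.insert_erase_mem hf hA hv
      have hgen : ∀ G ∈ gensOver m F f, insert a (G.erase v) ∈
          gensOver m F' (insert a (f.erase v)) := fun G hG =>
        h.insert_erase_mem_gensOver (h3.symm ▸ hG) (hA.trans hG.2.1) hv (by
          have := h.notMem
          grind)
      have hinj : ∀ G ∈ gensOver m F f, ∀ H ∈ gensOver m F f,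
          insert a (G.erase v) = insert a (H.erase v) → G = H := fun G hG H hH e => by
        rw [← (h.insert_erase_mem hG.1 (hA.trans hG.2.1) hv).2.2,
          ← (h.insert_erase_mem hH.1 (hA.trans hH.2.1) hv).2.2, e]
      exact (hF.two _ h1 (by omega) _ (hgen G hG) _ (hgen H hH) _ (hgen I hI)).imp
        (hinj G hG H hH) (Or.imp (hinj G hG I hI) (hinj H hH I hI))
    · have haf := h.fresh f hf
      -- A generator over `f` that contains `A` can only be `f ∪ A`, so `insert a f` represents no
      -- more than one generator.
      have hgen : ∀ G ∈ gensOver m F f, (if A ⊆ G then insert a f else G) ∈ gensOver m F' f := by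
        intro G hG
        split_ifs with hAG
        · refine ⟨(h.mem_iff _).2 ⟨?_, Or.inr ⟨by simp, ?_⟩⟩, by simp, ?_⟩
          · have := h.notMem
            grind
          · rw [Finset.erase_insert haf]
            exact h.lower _ hG.1 _ (Finset.union_subset hG.2.1 hAG)
          · rw [Finset.card_insert_of_notMem haf, hfc]
        · exact ⟨(h.mem_of_not_subset hG.1 hAG).1, hG.2⟩
      have hinj : ∀ G ∈ gensOver m F f, ∀ H ∈ gensOver m F f,
          (if A ⊆ G then insert a f else G) = (if A ⊆ H then insert a f else H) → G = H := by
        intro G hG H hH e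
        have haG := h.fresh G hG.1
        have haH := h.fresh H hH.1
        have hun : ∀ G ∈ gensOver m F f, A ⊆ G → f ∪ A = G := fun G hG hAG =>
          Finset.eq_of_subset_of_card_le (Finset.union_subset hG.2.1 hAG) (by
            rw [hG.2.2, ← hfc]
            refine Finset.card_lt_card ⟨Finset.subset_union_left, fun h' => hA ?_⟩
            exact Finset.subset_union_right.trans h')
        split_ifs at e with h1 h2 h2
        · rw [← hun G hG h1, ← hun H hH h2]
        · exact absurd (e ▸ Finset.mem_insert_self a f) haH
        · exact absurd (e ▸ Finset.mem_insert_self a f) haG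
        · exact e
      exact (hF.two _ (h.mem_of_not_subset hf hA).1 hfc _ (hgen G hG) _ (hgen H hH) _
        (hgen I hI)).imp (hinj G hG H hH) (Or.imp (hinj G hG I hI) (hinj H hH I hI))
  · obtain ⟨t, ht, rfl, -⟩ := h.exists_carrier_eq hne hB
    obtain ⟨X, hX, rfl⟩ := h.exists_lift ht hG
    obtain ⟨Y, hY, rfl⟩ := h.exists_lift ht hH
    exact Relation.ReflTransGen.lift (carrier A a) (fun _ _ => h.carrier_adj hd) _ _
      (hF.conn t ht X hX Y hY)

end StarringFamily

/-! ### Stellar manifolds are normal; consequences of connectedness and closedness. -/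

theorem isNormal_of_stellarEquiv {m : ℕ} {K L : Complex} (h : StellarEquiv K L)
    (hL : IsNormal m (augFaces L)) : IsNormal m (augFaces K) := by
  induction h using Relation.ReflTransGen.head_induction_on with
  | refl => exact hL
  | head h _ ih =>
    rcases h with ⟨A, hA, a, ha, rfl⟩ | ⟨A, hA, a, ha, rfl⟩ | ⟨f, hf, rfl⟩
    · exact (starringFamily hA ha).isNormal_of_starring (nonempty_of_mem hA) ih
    · exact (starringFamily hA ha).isNormal ih
    · exact ih.of_map hf

/-- Each condition concerns the star of a nonempty simplex, so it can be read off in the link of one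
of its vertices. The empty simplex is left out because links say nothing about global connectedness.
-/
theorem IsStellarManifold.isNormal {n : ℕ} {M : Complex} (hM : IsStellarManifold n M) :
    IsNormal (n + 1) M.faces := by
  have hlink : ∀ v ∈ vertices M, IsNormal n (augFaces (link {v} M)) := fun v hv =>
    (hM v hv).elim (fun h => isNormal_of_stellarEquiv h (isNormal_simplex n))
      (fun h => isNormal_of_stellarEquiv h (isNormal_simplexBoundary n))
  have hmem : ∀ v ∈ vertices M, ∀ s, v ∈ s → (s ∈ M.faces ↔ s.erase v ∈ augFaces (link {v} M)) := by
    intro v hv s hs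
    rw [mem_augFaces_link hv]
    have : {v} ∪ s.erase v = s := by grind
    rw [this]
    simp
  have hvert : ∀ s ∈ M.faces, ∃ v ∈ s, v ∈ vertices M := fun s hs => by
    obtain ⟨v, hv⟩ := nonempty_of_mem hs
    exact ⟨v, hv, mem_of_subset hs (by simpa using hv) (by simp)⟩
  have hgen : ∀ v ∈ vertices M, ∀ s, v ∈ s → ∀ G ∈ gensOver (n + 1) M.faces s,
      G.erase v ∈ gensOver n (augFaces (link {v} M)) (s.erase v) := fun v hv s hs G hG =>
    ⟨(hmem v hv G (hG.2.1 hs)).1 hG.1, Finset.erase_subset_erase v hG.2.1, by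
      rw [Finset.card_erase_of_mem (hG.2.1 hs), hG.2.2]; rfl⟩
  have hgen' : ∀ v ∈ vertices M, ∀ s, v ∈ s → ∀ G ∈ gensOver n (augFaces (link {v} M)) (s.erase v),
      v ∉ G ∧ insert v G ∈ gensOver (n + 1) M.faces s := fun v hv s hs G hG => by
    have hvG : v ∉ G := by
      have := ((mem_augFaces_link hv).1 hG.1).1
      simpa using this
    refine ⟨hvG, (hmem v hv _ (by simp)).2 ?_, ?_, ?_⟩
    · rw [Finset.erase_insert hvG]
      exact hG.1
    · have := hG.2.1
      grind
    · rw [Finset.card_insert_of_notMem hvG, hG.2.2]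
  refine ⟨fun s hs => ?_, fun s hs => ?_, fun f hf hfc G hG H hH I hI => ?_,
    fun B hB G hG H hH => ?_⟩
  · obtain ⟨v, hvs, hv⟩ := hvert s hs
    have := (hlink v hv).dim _ ((hmem v hv s hvs).1 hs)
    rw [← Finset.card_erase_add_one hvs]
    omega
  · obtain ⟨v, hvs, hv⟩ := hvert s hs
    obtain ⟨G, hG⟩ := (hlink v hv).pure _ ((hmem v hv s hvs).1 hs)
    exact ⟨_, (hgen' v hv s hvs G hG).2⟩
  · obtain ⟨v, hvs, hv⟩ := hvert f hf
    have hinj : ∀ G ∈ gensOver (n + 1) M.faces f, ∀ H ∈ gensOver (n + 1) M.faces f,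
        G.erase v = H.erase v → G = H := fun G hG H hH e => by
      rw [← Finset.insert_erase (hG.2.1 hvs), e, Finset.insert_erase (hH.2.1 hvs)]
    refine ((hlink v hv).two _ ((hmem v hv f hvs).1 hf) ?_ _ (hgen v hv f hvs G hG) _
      (hgen v hv f hvs H hH) _ (hgen v hv f hvs I hI)).imp (hinj G hG H hH)
      (Or.imp (hinj G hG I hI) (hinj H hH I hI))
    rw [Finset.card_erase_add_one hvs]
    omega
  · obtain ⟨v, hvs, hv⟩ := hvert B hB
    have := ((hlink v hv).conn _ ((hmem v hv B hvs).1 hB) _ (hgen v hv B hvs G hG) _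
      (hgen v hv B hvs H hH)).lift (p := AdjOver (n + 1) M.faces B) (insert v) ?_
    · rwa [Function.onFun, Finset.insert_erase (hG.2.1 hvs), Finset.insert_erase (hH.2.1 hvs)] at this
    · rintro X Y ⟨hX, hY, hc⟩
      obtain ⟨hvX, hX'⟩ := hgen' v hv B hvs X hX
      obtain ⟨hvY, hY'⟩ := hgen' v hv B hvs Y hY
      refine ⟨hX', hY', ?_⟩
      rw [← Finset.insert_inter_distrib, Finset.card_insert_of_notMem (by grind)]
      omega

theorem exists_crossing_facet {n : ℕ} {M : Complex} (hN : IsNormal (n + 1) M.faces)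
    (hconn : IsConnected (realization M)) (hfin : (generators (n + 1) M).Finite)
    {T : Set (Finset ℕ)} (hT : T ⊂ generators (n + 1) M) (hne : T.Nonempty) :
    ∃ G ∈ T, ∃ p ∈ generators (n + 1) M, p ∉ T ∧ ∃ f ∈ M.faces, f ⊆ G ∧ f ⊆ p ∧ f.card = n := by
  by_contra! hcon
  -- If no facet leads out of `T`, then connectedness of stars puts all generators over a nonempty
  -- simplex into `T` as soon as one of them is there.
  have hclosed : ∀ B ∈ M.faces, ∀ G ∈ gensOver (n + 1) M.faces B, G ∈ T →
      ∀ H ∈ gensOver (n + 1) M.faces B, H ∈ T := by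
    intro B hB G hG hGT H hH
    have := hN.conn B hB G hG H hH
    clear hH
    induction this with
    | refl => exact hGT
    | @tail X Y _ hXY ih =>
      by_contra hY
      have hne : (X ∩ Y).Nonempty :=
        (nonempty_of_mem hB).mono (Finset.subset_inter hXY.1.2.1 hXY.2.1.2.1)
      have hlt : (X ∩ Y).card < n + 1 := by
        rw [← hXY.1.2.2]
        refine Finset.card_lt_card ⟨Finset.inter_subset_left, fun h => hY ?_⟩
        have : X = Y := Finset.eq_of_subset_of_card_le
          (h.trans Finset.inter_subset_right) (by rw [hXY.1.2.2, hXY.2.1.2.2])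
        exact this ▸ ih
      have := hXY.2.2
      exact hcon X ih Y ⟨hXY.2.1.1, hXY.2.1.2.2⟩ hY (X ∩ Y)
        (mem_of_subset hXY.1.1 Finset.inter_subset_left hne) Finset.inter_subset_left
        Finset.inter_subset_right (by omega)
  have hTfin := hfin.subset hT.1
  set C : Finset ℕ := hTfin.toFinset.biUnion id with hC
  have hmemC : ∀ {v}, v ∈ C ↔ ∃ G ∈ T, v ∈ G := by simp [hC]
  -- Consequently the vertices of `T` span a union of components.
  have hsplit : ∀ s ∈ M.faces, s ⊆ C ∨ Disjoint s C := by
    intro s hs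
    by_cases hd : Disjoint s C
    · exact Or.inr hd
    · left
      obtain ⟨v, hvs, hvC⟩ := Finset.not_disjoint_iff.1 hd
      obtain ⟨G, hGT, hvG⟩ := hmemC.1 hvC
      obtain ⟨H, hH⟩ := hN.pure s hs
      have hH' : H ∈ T := hclosed {v} (mem_of_subset hs (by simpa using hvs) (by simp)) G
        ⟨(hT.1 hGT).1, by simpa using hvG, (hT.1 hGT).2⟩ hGT H
        ⟨hH.1, by simpa using hH.2.1 hvs, hH.2.2⟩
      exact fun w hw => hmemC.2 ⟨H, hH', hH.2.1 hw⟩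
  have hpt : ∀ G ∈ generators (n + 1) M, ∀ v ∈ G, Pi.single v (1 : ℝ) ∈ realization M := by
    intro G hG v hv
    refine ⟨fun i => ?_, {v}, mem_of_subset hG.1 (by simpa using hv) (by simp), fun i hi => ?_, ?_⟩
    · rw [Pi.single_apply]
      split_ifs <;> norm_num
    · rw [Pi.single_apply, if_neg (by simpa using hi)]
    · simp
  -- The sum of the barycentric coordinates over `C` is continuous and takes only the values 0 and
  -- 1; both occur, which contradicts connectedness.
  have hval : ∀ x ∈ realization M, ∑ i ∈ C, x i = 0 ∨ ∑ i ∈ C, x i = 1 := by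
    rintro x ⟨-, s, hs, h0, h1⟩
    rcases hsplit s hs with h | h
    · right
      rw [← h1]
      exact (Finset.sum_subset h fun i _ hi => h0 i hi).symm
    · left
      exact Finset.sum_eq_zero fun i hi => h0 i fun his => Finset.disjoint_left.1 h his hi
  have hcont : Continuous fun x : ℕ → ℝ => ∑ i ∈ C, x i := by fun_prop
  have himg := (hconn.isPreconnected.image _ hcont.continuousOn).ordConnected
  obtain ⟨G, hG⟩ := hne
  obtain ⟨p, hp, hpT⟩ := Set.exists_of_ssubset hT
  obtain ⟨v, hv⟩ := nonempty_of_mem (hT.1 hG).1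
  obtain ⟨w, hw⟩ := nonempty_of_mem hp.1
  have hwC : w ∉ C := by
    intro hwC
    obtain ⟨H, hHT, hwH⟩ := hmemC.1 hwC
    exact hpT (hclosed {w} (mem_of_subset hp.1 (by simpa using hw) (by simp)) H
      ⟨(hT.1 hHT).1, by simpa using hwH, (hT.1 hHT).2⟩ hHT p ⟨hp.1, by simpa using hw, hp.2⟩)
  have h0 : (0 : ℝ) ∈ (fun x : ℕ → ℝ => ∑ i ∈ C, x i) '' realization M :=
    ⟨_, hpt p hp w hw, by simp [hwC]⟩
  have h1 : (1 : ℝ) ∈ (fun x : ℕ → ℝ => ∑ i ∈ C, x i) '' realization M :=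
    ⟨_, hpt G (hT.1 hG) v hv, by simp [hmemC.2 ⟨G, hG, hv⟩]⟩
  obtain ⟨x, hx, hx'⟩ := himg.out h0 h1 (show (1 / 2 : ℝ) ∈ Set.Icc 0 1 by norm_num)
  rcases hval x hx with h | h <;> simp only [h] at hx' <;> norm_num at hx'

theorem exists_generator {n : ℕ} {M : Complex} (hN : IsNormal (n + 1) M.faces)
    (hconn : IsConnected (realization M)) : (generators (n + 1) M).Nonempty := by
  obtain ⟨x, -, s, hs, -⟩ := hconn.nonempty
  obtain ⟨G, hG⟩ := hN.pure s hs
  exact ⟨G, hG.1, hG.2.2⟩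

/-- In a closed complex every facet of a generator lies in a second generator. -/
theorem IsClosedComplex.exists_ne {n : ℕ} {M : Complex} (hfin : (generators (n + 1) M).Finite)
    (h : IsClosedComplex n M) {G f : Finset ℕ} (hG : G ∈ generators (n + 1) M) (hf : f ⊆ G)
    (hfc : f.card = n) : ∃ H ∈ generators (n + 1) M, H ≠ G ∧ f ⊆ H := by
  by_contra! hcon
  -- The coefficient of `f` in `∂M` counts modulo 2 the generators that contain `f`; if `G` were the
  -- only one, it would be 1.
  have hv : ∀ H ∈ generators (n + 1) M, chainBoundary H f = if f ⊆ H then 1 else 0 := by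
    intro H hH
    rw [chainBoundary, Finsupp.finsetSum_apply]
    split_ifs with hfH
    · obtain ⟨w, hw, rfl⟩ := exists_eq_insert_of_card hfH (by rw [hfc, hH.2])
      rw [Finset.sum_eq_single w]
      · simp [hw]
      · intro v hv hvw
        rw [Finsupp.single_eq_of_ne]
        intro e
        have : v ∈ f := by grind
        rw [e] at this
        simp at this
      · simp
    · refine Finset.sum_eq_zero fun v hv => Finsupp.single_eq_of_ne ?_
      rintro rfl
      exact hfH (Finset.erase_subset v H)
  have h1 := h
  rw [IsClosedComplex, finsum_mem_eq_finite_toFinset_sum _ hfin] at h1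
  have h2 := DFunLike.congr_fun h1 f
  rw [Finsupp.finsetSum_apply, Finset.sum_eq_single G] at h2
  · rw [hv G hG, if_pos hf] at h2
    simp at h2
  · intro H hH hne
    rw [Set.Finite.mem_toFinset] at hH
    rw [hv H hH, if_neg (hcon H hH hne)]
  · intro hG'
    exact absurd ((Set.Finite.mem_toFinset hfin).2 hG) hG'

/-! ### Generalized simplicial complexes and their starrings. -/

/-- A criterion for generalized simplicial complexes: the faces of each simplex are labelled by
the subsets of a finite set. -/
theorem isSimplicialPoset_of_labels {P : PartOrd.{0}} (hbot : ∃ b : P, IsBot b)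
    (h : ∀ x : P, ∃ (α : Type) (e : P → Finset α),
      (∀ y z, y ≤ x → z ≤ x → (e y ⊆ e z ↔ y ≤ z)) ∧ ∀ u ⊆ e x, ∃ y ≤ x, e y = u) :
    IsSimplicialPoset P := by
  classical
  refine ⟨hbot, fun x => ?_⟩
  obtain ⟨α, e, hle, hsurj⟩ := h x
  have hsub : ∀ y ≤ x, e y ⊆ e x := fun y hy => (hle y x hy le_rfl).2 hy
  let φ : Set.Iic x ↪o Finset (e x) := OrderEmbedding.ofMapLEIff
    (fun y => (e y.1).subtype (· ∈ e x)) (by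
      rintro ⟨y, hy⟩ ⟨z, hz⟩
      change Finset.subtype _ _ ⊆ Finset.subtype _ _ ↔ y ≤ z
      rw [← hle y z hy hz]
      constructor
      · intro h a ha
        have := @h ⟨a, hsub y hy ha⟩ (by simpa using ha)
        simpa using this
      · intro h a ha
        simp only [Finset.mem_subtype] at ha ⊢
        exact h ha)
  have hφ : Function.Surjective φ := by
    intro u
    obtain ⟨y, hy, hyu⟩ := hsurj (u.map (Function.Embedding.subtype _)) (by
      intro a ha
      obtain ⟨b, -, rfl⟩ := Finset.mem_map.1 ha
      exact b.2)
    refine ⟨⟨y, hy⟩, ?_⟩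
    change Finset.subtype _ (e y) = u
    rw [hyu]
    ext a
    simp
  let ε : e x ≃ Fin (e x).card := (e x).equivFin
  let ψ : Finset (e x) ≃o Finset (Fin (e x).card) :=
    { ε.finsetCongr with
      map_rel_iff' := by
        intro s t
        exact Finset.map_subset_map }
  exact ⟨(e x).card, ⟨(RelIso.ofSurjective φ hφ).trans ψ⟩⟩

theorem IsSimplicialPoset.of_orderIso {P Q : PartOrd.{0}} (e : P ≃o Q) (h : IsSimplicialPoset P) :
    IsSimplicialPoset Q := by
  obtain ⟨⟨b, hb⟩, hI⟩ := h
  refine ⟨⟨e b, fun y => by rw [← e.le_symm_apply]; exact hb _⟩, fun x => ?_⟩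
  obtain ⟨k, ⟨f⟩⟩ := hI (e.symm x)
  refine ⟨k, ⟨OrderIso.trans ?_ f⟩⟩
  exact
    { toFun := fun y => ⟨e.symm y.1, e.symm.monotone y.2⟩
      invFun := fun y => ⟨e y.1, (e.le_symm_apply).1 y.2⟩
      left_inv := fun y => by simp
      right_inv := fun y => by simp
      map_rel_iff' := by
        rintro ⟨y, hy⟩ ⟨z, hz⟩
        exact e.symm.le_iff_le }

/-- Every simplex that has a common upper bound with `A` has a join with `A`. -/
def HasLocalJoins (P : PartOrd.{0}) (A : P) : Prop :=
  ∀ x : P, ¬ A ≤ x → (∃ z, x ≤ z ∧ A ≤ z) → ∃ z, IsLeast {z | x ≤ z ∧ A ≤ z} z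

/-- The starring of `P` at `A` in case of local joins: old simplexes are marked by `false`, new ones
by `true`. -/
abbrev MarkedStarring (P : PartOrd.{0}) (A : P) : Type :=
  {q : P × Bool // ¬ A ≤ q.1 ∧ (q.2 = true → ∃ z, q.1 ≤ z ∧ A ≤ z)}

/-- With local joins the second entry of a pair is determined by the first and by whether the
simplex is old or new, so one bit replaces it. -/
theorem posetStarring_orderIso_marked {P : PartOrd.{0}} {A : P} (h : HasLocalJoins P A) :
    Nonempty (PosetStarring P A ≃o PartOrd.of (MarkedStarring P A)) := by
  classical
  have hz : ∀ q : PosetStarring P A, q.1.2 ≠ q.1.1 ↔ A ≤ q.1.2 := by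
    rintro ⟨⟨x, z⟩, hx, hz⟩
    constructor
    · intro hne
      exact (hz.resolve_left hne).1.2
    · intro hA hne
      exact hx (hA.trans (le_of_eq hne))
  have hmin : ∀ q : PosetStarring P A, A ≤ q.1.2 → IsLeast {z | q.1.1 ≤ z ∧ A ≤ z} q.1.2 := by
    intro q hq
    have hm := q.2.2.resolve_left ((hz q).2 hq)
    obtain ⟨w, hw⟩ := h q.1.1 q.2.1 ⟨_, hm.1⟩
    have : w = q.1.2 := le_antisymm (hw.2 hm.1) (hm.2 hw.1 (hw.2 hm.1))
    rwa [← this]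
  let f : PosetStarring P A → MarkedStarring P A := fun q =>
    ⟨(q.1.1, decide (A ≤ q.1.2)), q.2.1, fun hq => ⟨q.1.2, (hmin q (by simpa using hq)).1⟩⟩
  have hf : ∀ q r, f q ≤ f r ↔ q ≤ r := by
    intro q r
    change (q.1.1 ≤ r.1.1 ∧ decide (A ≤ q.1.2) ≤ decide (A ≤ r.1.2)) ↔
      q.1.1 ≤ r.1.1 ∧ q.1.2 ≤ r.1.2
    refine and_congr_right fun hqr => ?_
    by_cases hq : A ≤ q.1.2 <;> by_cases hr : A ≤ r.1.2
    · simp only [hq, hr, decide_true, le_refl, true_iff]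
      exact (hmin q hq).2 ⟨hqr.trans (hmin r hr).1.1, hr⟩
    · simp only [hq, hr, decide_true, decide_false]
      refine ⟨fun h => absurd h (by decide), fun h => absurd (hq.trans h) hr⟩
    · simp only [hq, hr, decide_true, decide_false, Bool.false_le, true_iff]
      rw [show q.1.2 = q.1.1 from not_not.1 fun h => hq ((hz q).1 h)]
      exact hqr.trans (hmin r hr).1.1
    · simp only [hq, hr, decide_false, le_refl, true_iff]
      rw [show q.1.2 = q.1.1 from not_not.1 fun h => hq ((hz q).1 h),
        show r.1.2 = r.1.1 from not_not.1 fun h => hr ((hz r).1 h)]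
      exact hqr
  have hs : Function.Surjective f := by
    rintro ⟨⟨x, β⟩, hx, hβ⟩
    cases β
    · refine ⟨⟨(x, x), hx, Or.inl rfl⟩, ?_⟩
      simp [f, hx]
    · obtain ⟨z, hzl⟩ := h x hx (hβ rfl)
      have hzm : Minimal (fun z => x ≤ z ∧ A ≤ z) z := ⟨hzl.1, fun w hw _ => hzl.2 hw⟩
      refine ⟨⟨(x, z), hx, Or.inr hzm⟩, ?_⟩
      simp [f, hzl.1.2]
  exact ⟨RelIso.ofSurjective (OrderEmbedding.ofMapLEIff f hf) hs⟩

/-- Starrings agree when the simplexes that do not contain the starred simplex agree, together with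
those of them that lie in a common simplex with it. -/
theorem posetStarring_congr {P Q : PartOrd.{0}} {A : P} {B : Q} (hP : HasLocalJoins P A)
    (hQ : HasLocalJoins Q B) (e : {x : P // ¬ A ≤ x} ≃o {y : Q // ¬ B ≤ y})
    (he : ∀ x, (∃ z, x.1 ≤ z ∧ A ≤ z) ↔ ∃ z, (e x).1 ≤ z ∧ B ≤ z) :
    Nonempty (PosetStarring P A ≃o PosetStarring Q B) := by
  obtain ⟨e₁⟩ := posetStarring_orderIso_marked hP
  obtain ⟨e₂⟩ := posetStarring_orderIso_marked hQ
  let f : MarkedStarring P A → MarkedStarring Q B := fun q =>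
    ⟨((e ⟨q.1.1, q.2.1⟩).1, q.1.2), (e _).2, fun h => (he ⟨q.1.1, q.2.1⟩).1 (q.2.2 h)⟩
  have hf : ∀ q r, f q ≤ f r ↔ q ≤ r := fun q r => and_congr_left' e.le_iff_le
  have hs : Function.Surjective f := by
    rintro ⟨⟨y, β⟩, hy, hβ⟩
    refine ⟨⟨((e.symm ⟨y, hy⟩).1, β), (e.symm _).2, fun h => ?_⟩, by simp [f]⟩
    rw [he]
    simpa using hβ h
  exact ⟨(e₁.trans (RelIso.ofSurjective (OrderEmbedding.ofMapLEIff f hf) hs)).trans e₂.symm⟩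

/-- In the marked form a face of a new simplex is a face of its old part together with the choice
whether to include the new vertex. -/
theorem IsSimplicialPoset.starring {P : PartOrd.{0}} (hP : IsSimplicialPoset P) {A : P}
    (hA : ¬ IsBot A) (h : HasLocalJoins P A) : IsSimplicialPoset (PosetStarring P A) := by
  classical
  obtain ⟨e₁⟩ := posetStarring_orderIso_marked h
  refine IsSimplicialPoset.of_orderIso e₁.symm ?_
  obtain ⟨⟨b, hb⟩, hI⟩ := hP
  have hAb : ¬ A ≤ b := fun h => hA fun x => h.trans (hb x)
  refine isSimplicialPoset_of_labels ⟨⟨(b, false), hAb, by simp⟩, fun q => ⟨hb _, Bool.false_le _⟩⟩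
    fun x => ?_
  obtain ⟨k, ⟨f⟩⟩ := hI x.1.1
  let g : P → Finset (Fin k) := fun y => if hy : y ≤ x.1.1 then f ⟨y, hy⟩ else ∅
  have hg : ∀ y z, y ≤ x.1.1 → z ≤ x.1.1 → (g y ⊆ g z ↔ y ≤ z) := by
    intro y z hy hz
    simp only [g, hy, hz, dif_pos]
    exact f.le_iff_le
  -- The label `none` stands for the new vertex.
  let e : MarkedStarring P A → Finset (Option (Fin k)) := fun y =>
    (g y.1.1).map Function.Embedding.some ∪ (if y.1.2 then {none} else ∅)
  have hnone : ∀ y : MarkedStarring P A, none ∈ e y ↔ y.1.2 = true := by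
    intro y
    cases hy : y.1.2 <;> simp [e, hy]
  have hsome : ∀ (y : MarkedStarring P A) i, some i ∈ e y ↔ i ∈ g y.1.1 := by
    intro y i
    cases hy : y.1.2 <;> simp [e, hy]
  refine ⟨Option (Fin k), e, fun y z hy hz => ?_, fun u hu => ?_⟩
  · change _ ↔ y.1.1 ≤ z.1.1 ∧ y.1.2 ≤ z.1.2
    rw [← hg _ _ hy.1 hz.1]
    constructor
    · refine fun hyz => ⟨fun i hi => (hsome z i).1 (hyz ((hsome y i).2 hi)), ?_⟩
      rw [Bool.le_iff_imp]
      exact fun hi => (hnone z).1 (hyz ((hnone y).2 hi))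
    · rintro ⟨h1, h2⟩ (_ | i) hi
      · exact (hnone z).2 (Bool.le_iff_imp.1 h2 ((hnone y).1 hi))
      · exact (hsome z i).2 (h1 ((hsome y i).1 hi))
  · obtain ⟨y, hy⟩ := f.surjective (Finset.univ.filter fun i => some i ∈ u)
    have hAy : ¬ A ≤ y.1 := fun h => x.2.1 (h.trans y.2)
    have hux : none ∈ u → x.1.2 = true := fun h => (hnone x).1 (hu h)
    have hyx : y.1 ≤ x.1.1 := y.2
    refine ⟨⟨(y.1, decide (none ∈ u)), hAy, fun h => ?_⟩, ⟨hyx, ?_⟩, ?_⟩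
    · obtain ⟨z, hz⟩ := x.2.2 (hux (by simpa using h))
      exact ⟨z, hyx.trans hz.1, hz.2⟩
    · rw [Bool.le_iff_imp]
      exact fun h => hux (by simpa using h)
    · ext (_ | i)
      · rw [hnone]
        simp
      · rw [hsome]
        simp [g, hyx, hy]

theorem antisymmetrization_orderIso {α β : Type} [Preorder α] [PartialOrder β] {f : α → β}
    (hf : ∀ x y, f x ≤ f y ↔ x ≤ y) (hs : Function.Surjective f) :
    Nonempty (Antisymmetrization α (· ≤ ·) ≃o β) := by
  let g : Antisymmetrization α (· ≤ ·) → β := fun x => f (ofAntisymmetrization _ x)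
  refine ⟨RelIso.ofSurjective (OrderEmbedding.ofMapLEIff g fun x y => ?_) fun b => ?_⟩
  · rw [hf, ofAntisymmetrization_le_ofAntisymmetrization_iff]
  · obtain ⟨x, rfl⟩ := hs b
    refine ⟨toAntisymmetrization _ x, ?_⟩
    have h : toAntisymmetrization (α := α) (· ≤ ·) (ofAntisymmetrization (· ≤ ·)
      (toAntisymmetrization (· ≤ ·) x)) = toAntisymmetrization (· ≤ ·) x :=
      toAntisymmetrization_ofAntisymmetrization _ _
    apply le_antisymm
    · exact (hf _ _).2 (toAntisymmetrization_le_toAntisymmetrization_iff.1 h.le)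
    · exact (hf _ _).2 (toAntisymmetrization_le_toAntisymmetrization_iff.1 h.ge)

/-! ### Names of vertices. -/

/-- Every vertex of an unfolding carries the name of a vertex of the folded complex; each name is
carried by infinitely many integers. -/
def label (k : ℕ) : ℕ := k.unpair.1

/-- The set of names of the vertices of `s`. -/
def labels (s : Finset ℕ) : Finset ℕ := s.image label

theorem labels_mono {s t : Finset ℕ} (h : s ⊆ t) : labels s ⊆ labels t :=
  Finset.image_subset_image h

theorem mem_labels {s : Finset ℕ} {v : ℕ} : v ∈ labels s ↔ ∃ x ∈ s, label x = v :=
  Finset.mem_image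

theorem label_mem_labels {s : Finset ℕ} {x : ℕ} (h : x ∈ s) : label x ∈ labels s :=
  Finset.mem_image_of_mem _ h

theorem labels_insert (c : ℕ) (s : Finset ℕ) : labels (insert c s) = insert (label c) (labels s) :=
  Finset.image_insert _ _ _

theorem card_labels {s : Finset ℕ} (h : Set.InjOn label s) : (labels s).card = s.card :=
  Finset.card_image_of_injOn h

theorem exists_label_eq (b : ℕ) {V : Set ℕ} (hV : V.Finite) : ∃ c ∉ V, label c = b := by
  have hinj : Function.Injective (Nat.pair b) := fun x y h => (Nat.pair_eq_pair.1 h).2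
  obtain ⟨_, ⟨i, rfl⟩, hi⟩ := (Set.infinite_range_of_injective hinj).exists_notMem_finite hV
  exact ⟨_, hi, by simp [label]⟩

/-- The part of `s` whose vertices have names in `A`. -/
def partOver (A s : Finset ℕ) : Finset ℕ := s.filter (label · ∈ A)

theorem mem_partOver {A s : Finset ℕ} {x : ℕ} : x ∈ partOver A s ↔ x ∈ s ∧ label x ∈ A :=
  Finset.mem_filter

theorem partOver_subset (A s : Finset ℕ) : partOver A s ⊆ s := Finset.filter_subset _ _

theorem labels_partOver {A s : Finset ℕ} (h : A ⊆ labels s) : labels (partOver A s) = A := by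
  ext v
  rw [mem_labels]
  constructor
  · rintro ⟨x, hx, rfl⟩
    exact (mem_partOver.1 hx).2
  · intro hv
    obtain ⟨x, hx, rfl⟩ := mem_labels.1 (h hv)
    exact ⟨x, mem_partOver.2 ⟨hx, hv⟩, rfl⟩

theorem partOver_subset_of_injOn {A s t : Finset ℕ} (hinj : Set.InjOn label s) (ht : t ⊆ s)
    (h : A ⊆ labels t) : partOver A s ⊆ t := by
  intro x hx
  rw [mem_partOver] at hx
  obtain ⟨y, hy, hyx⟩ := mem_labels.1 (h hx.2)
  rwa [← hinj (ht hy) hx.1 hyx]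

theorem partOver_labels {s t : Finset ℕ} (hinj : Set.InjOn label s) (ht : t ⊆ s) :
    partOver (labels t) s = t :=
  (partOver_subset_of_injOn hinj ht subset_rfl).antisymm fun _ hx =>
    mem_partOver.2 ⟨ht hx, label_mem_labels hx⟩

/-! ### Cells and unfoldings. -/

/-- The simplexes of partially coned complexes: simplexes of the folded complex and cones over
simplexes of the unfolding. -/
inductive Cell
  | base (A : Finset ℕ)
  | cone (s : Finset ℕ)

namespace Cell

/-- The face relation between cells: the base of a cone is folded. -/
def Face : Cell → Cell → Prop
  | base A, base B => A ⊆ B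
  | base A, cone s => A ⊆ labels s
  | cone _, base _ => False
  | cone s, cone t => s ⊆ t

instance : PartialOrder Cell where
  le := Face
  le_refl x := by cases x <;> exact subset_rfl
  le_trans := by
    rintro (_ | _) (_ | _) (_ | _) h1 h2
    all_goals first
      | exact Finset.Subset.trans h1 h2
      | exact Finset.Subset.trans h1 (labels_mono h2)
      | exact h1.elim
      | exact h2.elim
  le_antisymm := by
    rintro (_ | _) (_ | _) h1 h2
    · exact congrArg base (Finset.Subset.antisymm h1 h2)
    · exact h2.elim
    · exact h1.elim
    · exact congrArg cone (Finset.Subset.antisymm h1 h2)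

theorem base_le_base {A B : Finset ℕ} : base A ≤ base B ↔ A ⊆ B := Iff.rfl
theorem base_le_cone {A s : Finset ℕ} : base A ≤ cone s ↔ A ⊆ labels s := Iff.rfl
theorem not_cone_le_base {A s : Finset ℕ} : ¬ cone s ≤ base A := id
theorem cone_le_cone {s t : Finset ℕ} : cone s ≤ cone t ↔ s ⊆ t := Iff.rfl

end Cell

/-- The cells of the complex obtained from `M` by deleting the simplexes in `D` and attaching the
cone over `S`. -/
def cells (M : Complex) (D : Set (Finset ℕ)) (S : Complex) : Set Cell
  | .base A => A ∈ augFaces M ∧ A ∉ D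
  | .cone s => s ∈ augFaces S

theorem base_mem_cells {M : Complex} {D : Set (Finset ℕ)} {S : Complex} {A : Finset ℕ} :
    Cell.base A ∈ cells M D S ↔ A ∈ augFaces M ∧ A ∉ D := Iff.rfl

theorem cone_mem_cells {M : Complex} {D : Set (Finset ℕ)} {S : Complex} {s : Finset ℕ} :
    Cell.cone s ∈ cells M D S ↔ s ∈ augFaces S := Iff.rfl

/-- The generalized simplicial complex of the cells of `M`, `D` and `S`. -/
abbrev cellPoset (M : Complex) (D : Set (Finset ℕ)) (S : Complex) : PartOrd.{0} :=
  PartOrd.of (cells M D S)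

/-- The generators in `T` of the manifold `M` are unfolded along a tree: the generator `G` is
lifted to the simplex `l G`, the lifts are glued to a ball along the lifts of the facets in `D`,
and `S` is the boundary sphere of that ball. -/
structure Unfolding (n : ℕ) (M : Complex) (T D : Set (Finset ℕ)) (S : Complex)
    (l : Finset ℕ → Finset ℕ) : Prop where
  normal : IsNormal (n + 1) M.faces
  finite : (generators (n + 1) M).Finite
  sphere : IsStellarSphere n S
  subset : T ⊆ generators (n + 1) M
  labels_lift : ∀ G ∈ T, labels (l G) = G
  injOn : ∀ G ∈ T, Set.InjOn label (l G)
  subset_deleted : T ⊆ D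
  deleted : ∀ A ∈ D, A ∈ T ∨ (A ∈ M.faces ∧ A.card = n ∧ ∃ G ∈ T, ∃ H ∈ T, G ≠ H ∧
    ∃ s, s ⊆ l G ∧ s ⊆ l H ∧ labels s = A)
  mem_sphere : ∀ G ∈ T, ∀ s ⊆ l G, labels s ∉ D → s ∈ augFaces S
  sphere_lift : ∀ s ∈ augFaces S, labels s ∉ D ∧ ∃ G ∈ T, s ⊆ l G
  -- In the closed case this keeps a generator of `S` from being its own partner.
  unique : ∀ s ∈ augFaces S, s.card = n → ∀ G ∈ T, ∀ H ∈ T, s ⊆ l G → s ⊆ l H → G = H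

namespace Unfolding

variable {n : ℕ} {M S : Complex} {T D : Set (Finset ℕ)} {l : Finset ℕ → Finset ℕ}

theorem mem_gensOver {F : Set (Finset ℕ)} (hT : T ⊆ {s | s ∈ F ∧ s.card = n + 1}) {G A : Finset ℕ}
    (hG : G ∈ T) (hA : A ⊆ G) : G ∈ gensOver (n + 1) F A := ⟨(hT hG).1, hA, (hT hG).2⟩

theorem eq_of_subset (U : Unfolding n M T D S l) {G A : Finset ℕ} (hG : G ∈ generators (n + 1) M)
    (hA : A ∈ M.faces) (h : G ⊆ A) : A = G :=
  (Finset.eq_of_subset_of_card_le h (by rw [hG.2]; exact U.normal.dim A hA)).symm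

/-- This makes the remaining base cells closed under faces. A deleted facet already lies in two
generators of `T`, so it lies in no others, and those two are deleted as well. -/
theorem deleted_upper (U : Unfolding n M T D S l) {A B : Finset ℕ} (hA : A ∈ D) (h : A ⊆ B)
    (hB : B ∈ M.faces) : B ∈ D := by
  rcases U.deleted A hA with hA' | ⟨hAM, hAc, G, hG, H, hH, hne, s, hsG, hsH, rfl⟩
  · rwa [U.eq_of_subset (U.subset hA') hB h]
  · have hBc := U.normal.dim B hB
    rcases (Finset.card_le_card h).lt_or_eq with hlt | heq
    · have hBg : B ∈ gensOver (n + 1) M.faces (labels s) := ⟨hB, h, by omega⟩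
      have hGs : labels s ⊆ G := U.labels_lift G hG ▸ labels_mono hsG
      have hHs : labels s ⊆ H := U.labels_lift H hH ▸ labels_mono hsH
      rcases U.normal.two _ hAM (by omega) B hBg G (mem_gensOver U.subset hG hGs) H
        (mem_gensOver U.subset hH hHs) with h | h | h
      · exact h ▸ U.subset_deleted hG
      · exact h ▸ U.subset_deleted hH
      · exact absurd h hne
    · rwa [← Finset.eq_of_subset_of_card_le h heq.ge]

theorem empty_notMem_deleted (U : Unfolding n M T D S l) : ∅ ∉ D := by
  intro h
  rcases U.deleted ∅ h with h | h
  · exact absurd (U.subset h).2 (by simp)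
  · exact absurd (nonempty_of_mem h.1) (by simp)

theorem injOn_sphere (U : Unfolding n M T D S l) {s : Finset ℕ} (hs : s ∈ augFaces S) :
    Set.InjOn label s := by
  obtain ⟨-, G, hG, hsG⟩ := U.sphere_lift s hs
  exact (U.injOn G hG).mono hsG

theorem labels_mem (U : Unfolding n M T D S l) {s : Finset ℕ} (hs : s ∈ augFaces S) :
    labels s ∈ augFaces M := by
  obtain ⟨-, G, hG, hsG⟩ := U.sphere_lift s hs
  exact augFaces_of_subset (Or.inr (U.subset hG).1) (U.labels_lift G hG ▸ labels_mono hsG)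

theorem card_le (U : Unfolding n M T D S l) {s : Finset ℕ} (hs : s ∈ augFaces S) :
    s.card ≤ n := by
  obtain ⟨hD, G, hG, hsG⟩ := U.sphere_lift s hs
  have h1 : labels s ⊆ G := U.labels_lift G hG ▸ labels_mono hsG
  have h2 : labels s ⊂ G :=
    h1.ssubset_of_ne (fun h => hD (h ▸ U.subset_deleted hG))
  have h3 := Finset.card_lt_card h2
  rw [(U.subset hG).2, card_labels (U.injOn_sphere hs)] at h3
  omega

theorem finite_lift (U : Unfolding n M T D S l) : (⋃ G ∈ T, (l G : Set ℕ)).Finite :=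
  (U.finite.subset U.subset).biUnion fun G _ => (l G).finite_toSet

theorem vertices_subset (U : Unfolding n M T D S l) : vertices S ⊆ ⋃ G ∈ T, (l G : Set ℕ) := by
  intro v hv
  obtain ⟨-, G, hG, hs⟩ := U.sphere_lift {v} (Or.inr hv)
  exact Set.mem_biUnion hG (by simpa using hs)

theorem isSimplicialPoset (U : Unfolding n M T D S l) : IsSimplicialPoset (cellPoset M D S) := by
  have hlow : ∀ {A B}, A ⊆ B → Cell.base B ∈ cells M D S → Cell.base A ∈ cells M D S := by
    intro A B hAB hB
    refine ⟨augFaces_of_subset hB.1 hAB, fun hA => ?_⟩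
    rcases hB.1 with rfl | hBM
    · rw [Finset.subset_empty] at hAB
      exact U.empty_notMem_deleted (hAB ▸ hA)
    · exact hB.2 (U.deleted_upper hA hAB hBM)
  refine isSimplicialPoset_of_labels
    ⟨⟨.base ∅, empty_mem_augFaces M, U.empty_notMem_deleted⟩, ?_⟩ ?_
  · rintro ⟨A | s, h⟩ <;> exact Finset.empty_subset _
  · rintro ⟨A | s, hx⟩
    · refine ⟨ℕ, fun y => match y.1 with
        | .base B => B
        | .cone _ => ∅, ?_, ?_⟩
      · rintro ⟨B | t, hB⟩ ⟨C | t', hC⟩ hy hz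
        · exact Iff.rfl
        · exact hz.elim
        · exact hy.elim
        · exact hz.elim
      · intro u hu
        exact ⟨⟨.base u, hlow hu hx⟩, hu, rfl⟩
    · have hinj := U.injOn_sphere hx
      -- The label `none` is the apex. A base face is labelled by the vertices of `s` above it,
      -- which is faithful because names are distinct on `s`.
      refine ⟨Option ℕ, fun y => match y.1 with
        | .base B => (partOver B s).map Function.Embedding.some
        | .cone t => Finset.insertNone t, ?_, ?_⟩
      · rintro ⟨B | t, hB⟩ ⟨C | t', hC⟩ hy hz
        · change _ ↔ B ⊆ C
          have hB' : B ⊆ labels s := hy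
          simp only [Finset.map_subset_map]
          constructor
          · intro h
            rw [← labels_partOver hB', ← labels_partOver (show C ⊆ labels s from hz)]
            exact labels_mono h
          · intro h x hx
            rw [mem_partOver] at hx ⊢
            exact ⟨hx.1, h hx.2⟩
        · change _ ↔ B ⊆ labels t'
          have hB' : B ⊆ labels s := hy
          have ht' : t' ⊆ s := hz
          have h1 : (partOver B s).map Function.Embedding.some ⊆ Finset.insertNone t' ↔
              partOver B s ⊆ t' := by
            constructor
            · intro h x hx
              simpa using h (Finset.mem_map_of_mem _ hx)
            · intro h x hx
              obtain ⟨y, hy, rfl⟩ := Finset.mem_map.1 hx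
              simpa using h hy
          rw [h1]
          constructor
          · intro h
            rw [← labels_partOver hB']
            exact labels_mono h
          · exact partOver_subset_of_injOn hinj ht'
        · change _ ↔ False
          rw [iff_false]
          intro h
          have := h (Finset.none_mem_insertNone)
          simp at this
        · change _ ↔ t ⊆ t'
          exact Finset.insertNone.le_iff_le
      · intro u hu
        by_cases hn : none ∈ u
        · have h1 : Finset.eraseNone u ⊆ s := by
            intro x hx
            have := hu (Finset.mem_eraseNone.1 hx)
            simpa using this
          refine ⟨⟨.cone (Finset.eraseNone u), augFaces_of_subset hx h1⟩, h1, ?_⟩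
          ext (_ | x) <;> simp [hn]
        · have h1 : Finset.eraseNone u ⊆ s := by
            intro x hx
            have := hu (Finset.mem_eraseNone.1 hx)
            simpa using this
          refine ⟨⟨.base (labels (Finset.eraseNone u)), ?_⟩, labels_mono h1, ?_⟩
          · exact hlow (labels_mono h1) ⟨U.labels_mem hx, (U.sphere_lift s hx).1⟩
          · change (partOver (labels (Finset.eraseNone u)) s).map _ = u
            rw [partOver_labels hinj h1]
            ext (_ | x) <;> simp [hn]

end Unfolding

/-! ### Unfolding the first generator. -/

theorem isRelabelling_simplexBoundary (A : Finset ℕ) :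
    IsRelabelling (simplexBoundary A) (simplexBoundary (Finset.range A.card)) := by
  let f : ℕ → ℕ := fun x => if h : x ∈ A then A.equivFin ⟨x, h⟩ else 0
  have hf : ∀ x (h : x ∈ A), f x = A.equivFin ⟨x, h⟩ := fun x h => dif_pos h
  have hinj : Set.InjOn f A := by
    intro x hx y hy hxy
    rw [hf x hx, hf y hy] at hxy
    simpa using A.equivFin.injective (Fin.val_injective hxy)
  have himg : A.image f = Finset.range A.card := by
    refine Finset.eq_of_subset_of_card_le ?_ ?_
    · intro y hy
      obtain ⟨x, hx, rfl⟩ := Finset.mem_image.1 hy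
      rw [hf x hx]
      simp
    · rw [Finset.card_image_of_injOn hinj, Finset.card_range]
  refine ⟨f, hinj.mono fun v hv => ?_, ?_⟩
  · have : {v} ⊂ A := hv.2
    simpa using this.1
  · apply PreAbstractSimplicialComplex.ext
    ext t
    rw [← himg]
    constructor
    · rintro ⟨hne, ht⟩
      obtain ⟨s, hs, rfl⟩ := Finset.subset_image_iff.1 ht.1
      refine ⟨s, ⟨Finset.image_nonempty.1 hne, ?_⟩, rfl⟩
      refine (Finset.coe_subset.1 hs).ssubset_of_ne ?_
      rintro rfl
      exact ht.2 subset_rfl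
    · rintro ⟨s, ⟨hne, hs⟩, rfl⟩
      refine ⟨hne.image f, Finset.image_subset_image hs.1, fun h => hs.2 fun x hx => ?_⟩
      obtain ⟨y, hy, hyx⟩ := Finset.mem_image.1 (h (Finset.mem_image_of_mem f hx))
      rwa [← hinj (hs.1 hy) hx hyx]

/-- The unfolding of a single generator. -/
theorem unfolding_single {n : ℕ} {M : Complex} (hN : IsNormal (n + 1) M.faces)
    (hfin : (generators (n + 1) M).Finite) {G : Finset ℕ} (hG : G ∈ generators (n + 1) M) :
    Unfolding n M {G} {G} (simplexBoundary (G.image (Nat.pair · 0)))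
      (fun _ => G.image (Nat.pair · 0)) := by
  -- The integer `Nat.pair v 0` carries the name `v`.
  have hlab : labels (G.image (Nat.pair · 0)) = G := by
    simp [labels, Finset.image_image, Function.comp_def, label]
  have hinj : Set.InjOn label (G.image (Nat.pair · 0) : Finset ℕ) := by
    intro x hx y hy hxy
    simp only [Finset.coe_image, Set.mem_image, Finset.mem_coe] at hx hy
    obtain ⟨x, hx, rfl⟩ := hx
    obtain ⟨y, hy, rfl⟩ := hy
    simp only [label, Nat.unpair_pair] at hxy
    rw [hxy]
  have hcard : (G.image (Nat.pair · 0)).card = n + 1 := by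
    rw [← card_labels hinj, hlab, hG.2]
  have hne : (G.image (Nat.pair · 0)).Nonempty := (nonempty_of_mem hG.1).image _
  refine ⟨hN, hfin, ?_, by simpa using hG, by simpa using hlab, by simpa using hinj, subset_rfl,
    fun A hA => Or.inl hA, ?_, ?_, ?_⟩
  · exact Relation.ReflTransGen.single (.relabelling (hcard ▸ isRelabelling_simplexBoundary _))
  · intro H _ s hs hD
    rw [mem_augFaces_simplexBoundary hne]
    refine hs.ssubset_of_ne ?_
    rintro rfl
    exact hD hlab
  · intro s hs
    rw [mem_augFaces_simplexBoundary hne] at hs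
    refine ⟨fun h => ?_, G, rfl, hs.1⟩
    have h1 := card_labels (hinj.mono hs.1)
    rw [show labels s = G from h, hG.2, ← hcard] at h1
    exact absurd h1 (Finset.card_lt_card hs).ne'
  · rintro s - - _ rfl _ rfl - -
    rfl

theorem isSimplicialPoset_facePoset (M : Complex) :
    IsSimplicialPoset (PartOrd.of (FacePoset M)) :=
  isSimplicialPoset_of_labels ⟨⟨∅, empty_mem_augFaces M⟩, fun y => Finset.empty_subset y.1⟩
    fun x => ⟨ℕ, fun y => y.1, fun _ _ _ _ => Iff.rfl,
      fun u hu => ⟨⟨u, augFaces_of_subset x.2 hu⟩, hu, rfl⟩⟩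

/-- Coning off a single generator is a subdivision. -/
theorem posetStellarEquiv_single {n : ℕ} {M : Complex} (hN : IsNormal (n + 1) M.faces)
    (hfin : (generators (n + 1) M).Finite) {G : Finset ℕ} (hG : G ∈ generators (n + 1) M) :
    PosetStellarEquiv (PartOrd.of (FacePoset M))
      (cellPoset M {G} (simplexBoundary (G.image (Nat.pair · 0)))) := by
  have U := unfolding_single hN hfin hG
  have hne : (G.image (Nat.pair · 0)).Nonempty := (nonempty_of_mem hG.1).image _
  let P := PartOrd.of (FacePoset M)
  let A : P := ⟨G, Or.inr hG.1⟩
  have hmax : ∀ B ∈ augFaces M, G ⊆ B → B = G := by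
    rintro B (rfl | hB) h
    · exact absurd (Finset.subset_empty.1 h) (nonempty_of_mem hG.1).ne_empty
    · exact U.eq_of_subset hG hB h
  -- The generator `G` is maximal, so it is the only simplex above `A`.
  have hJ : HasLocalJoins P A := by
    rintro x - ⟨z, hxz, hAz⟩
    refine ⟨z, ⟨hxz, hAz⟩, fun w hw => ?_⟩
    have h1 : z.1 = G := hmax z.1 z.2 hAz
    change z.1 ⊆ w.1
    rw [h1]
    exact hw.2
  obtain ⟨e⟩ := posetStarring_orderIso_marked hJ
  have hlab : ∀ s : Finset ℕ, labels (s.image (Nat.pair · 0)) = s := fun s => by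
    simp [labels, Finset.image_image, Function.comp_def, label]
  let f : MarkedStarring P A → cells M {G} (simplexBoundary (G.image (Nat.pair · 0))) := fun q =>
    match q with
    | ⟨(x, false), h⟩ => ⟨.base x.1, x.2, fun h' => h.1 (le_of_eq (Subtype.ext h'.symm))⟩
    | ⟨(x, true), h⟩ => ⟨.cone (x.1.image (Nat.pair · 0)), by
        rw [cone_mem_cells, mem_augFaces_simplexBoundary hne]
        obtain ⟨z, hz1, hz2⟩ := h.2 rfl
        have h1 : x.1 ⊆ G := hmax z.1 z.2 hz2 ▸ hz1
        refine ⟨Finset.image_subset_image h1, fun h2 => h.1 ?_⟩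
        have := labels_mono h2
        rwa [hlab, hlab] at this⟩
  have hf : ∀ q r, f q ≤ f r ↔ q ≤ r := by
    rintro ⟨⟨x, _ | _⟩, hx⟩ ⟨⟨y, _ | _⟩, hy⟩
    · change x.1 ⊆ y.1 ↔ x.1 ⊆ y.1 ∧ false ≤ false
      simp
    · change x.1 ⊆ labels _ ↔ x.1 ⊆ y.1 ∧ false ≤ true
      rw [hlab]
      simp
    · change False ↔ x.1 ⊆ y.1 ∧ true ≤ false
      simp
    · change (_ : Finset ℕ) ⊆ _ ↔ x.1 ⊆ y.1 ∧ true ≤ true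
      simp only [le_refl, and_true]
      refine ⟨fun h => ?_, Finset.image_subset_image⟩
      have := labels_mono h
      rwa [hlab, hlab] at this
  have hs : Function.Surjective f := by
    rintro ⟨B | s, h⟩
    · refine ⟨⟨(⟨B, h.1⟩, false), fun h' => h.2 (hmax B h.1 h'), by simp⟩, rfl⟩
    · have hs := (mem_augFaces_simplexBoundary hne).1 h
      have h1 : (labels s).image (Nat.pair · 0) = s := by
        ext x
        simp only [Finset.mem_image, mem_labels]
        constructor
        · rintro ⟨v, ⟨y, hy, rfl⟩, rfl⟩
          obtain ⟨w, -, rfl⟩ := Finset.mem_image.1 (hs.1 hy)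
          simpa [label] using hy
        · intro hx
          refine ⟨label x, ⟨x, hx, rfl⟩, ?_⟩
          obtain ⟨w, -, rfl⟩ := Finset.mem_image.1 (hs.1 hx)
          simp [label]
      have h2 : labels s ⊆ G := by
        rw [← hlab G]
        exact labels_mono hs.1
      refine ⟨⟨(⟨labels s, U.labels_mem h⟩, true), fun h' => hs.2 ?_, fun _ => ⟨A, h2, le_rfl⟩⟩, ?_⟩
      · change G ⊆ labels s at h'
        rw [← h1]
        exact Finset.image_subset_image h'
      · exact Subtype.ext (congrArg Cell.cone h1)
  refine Relation.ReflTransGen.single (.subdivision (isSimplicialPoset_facePoset M)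
    U.isSimplicialPoset ⟨A, fun h => ?_, ⟨?_⟩⟩)
  · have : G ⊆ ∅ := h ⟨∅, empty_mem_augFaces M⟩
    exact (nonempty_of_mem hG.1).ne_empty (Finset.subset_empty.1 this)
  · exact (e.trans (RelIso.ofSurjective (OrderEmbedding.ofMapLEIff f hf) hs)).symm

/-! ### Unfolding one more generator across a facet. -/

/-- The data for unfolding one more generator `p` across a facet `f` that it shares with the
unfolded generator `G`; the integer `c` is the new vertex of the unfolding. -/
structure Crossing (n : ℕ) (M : Complex) (T D : Set (Finset ℕ)) (S : Complex)
    (l : Finset ℕ → Finset ℕ) (G p f : Finset ℕ) (c : ℕ) : Prop where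
  unfolding : Unfolding n M T D S l
  mem : G ∈ T
  gen : p ∈ generators (n + 1) M
  notMem : p ∉ T
  facet_mem : f ∈ M.faces
  facet_subset : f ⊆ G
  facet_card : f.card = n
  eq_insert : p = insert (label c) f
  label_notMem : label c ∉ f
  fresh : ∀ H ∈ T, c ∉ l H

namespace Crossing

variable {n : ℕ} {M S : Complex} {T D : Set (Finset ℕ)} {l : Finset ℕ → Finset ℕ}
  {G p f : Finset ℕ} {c : ℕ}

theorem notMem_vertices (C : Crossing n M T D S l G p f c) : c ∉ vertices S := by
  intro h
  obtain ⟨H, hH, hc⟩ := Set.mem_iUnion₂.1 (C.unfolding.vertices_subset h)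
  exact C.fresh H hH hc

theorem facet_subset_new (C : Crossing n M T D S l G p f c) : f ⊆ p := by
  rw [C.eq_insert]
  exact Finset.subset_insert _ _

theorem ne (C : Crossing n M T D S l G p f c) : G ≠ p := fun h => C.notMem (h ▸ C.mem)

theorem eq_or_eq (C : Crossing n M T D S l G p f c) {H : Finset ℕ}
    (hH : H ∈ generators (n + 1) M) (hf : f ⊆ H) : H = G ∨ H = p := by
  have hGg := C.unfolding.subset C.mem
  rcases C.unfolding.normal.two f C.facet_mem (by rw [C.facet_card]) H ⟨hH.1, hf, hH.2⟩ G
    ⟨hGg.1, C.facet_subset, hGg.2⟩ p ⟨C.gen.1, C.facet_subset_new, C.gen.2⟩ with h | h | h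
  · exact Or.inl h
  · exact Or.inr h
  · exact absurd h C.ne

theorem eq_of_mem (C : Crossing n M T D S l G p f c) {H : Finset ℕ} (hH : H ∈ T) (hf : f ⊆ H) :
    H = G :=
  (C.eq_or_eq (C.unfolding.subset hH) hf).resolve_right fun h => C.notMem (h ▸ hH)

/-- A deleted facet lies in two generators of `T`, whereas `G` is the only generator of `T` that
contains `f`. -/
theorem facet_notMem_deleted (C : Crossing n M T D S l G p f c) : f ∉ D := by
  intro h
  rcases C.unfolding.deleted f h with h | ⟨-, -, H, hH, I, hI, hne, s, hsH, hsI, rfl⟩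
  · have := (C.unfolding.subset h).2
    rw [C.facet_card] at this
    omega
  · apply hne
    rw [C.eq_of_mem hH (C.unfolding.labels_lift H hH ▸ labels_mono hsH),
      C.eq_of_mem hI (C.unfolding.labels_lift I hI ▸ labels_mono hsI)]

theorem new_notMem_deleted (C : Crossing n M T D S l G p f c) : p ∉ D := by
  intro h
  rcases C.unfolding.deleted p h with h | ⟨-, h, -⟩
  · exact C.notMem h
  · rw [C.gen.2] at h
    omega

theorem labels_facet (C : Crossing n M T D S l G p f c) : labels (partOver f (l G)) = f :=
  labels_partOver (by rw [C.unfolding.labels_lift G C.mem]; exact C.facet_subset)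

theorem lift_mem_aug (C : Crossing n M T D S l G p f c) : partOver f (l G) ∈ augFaces S :=
  C.unfolding.mem_sphere G C.mem _ (partOver_subset _ _)
    (by rw [C.labels_facet]; exact C.facet_notMem_deleted)

theorem lift_nonempty (C : Crossing n M T D S l G p f c) : (partOver f (l G)).Nonempty := by
  have := nonempty_of_mem C.facet_mem
  rw [← C.labels_facet] at this
  exact Finset.image_nonempty.1 this

theorem lift_mem (C : Crossing n M T D S l G p f c) : partOver f (l G) ∈ S.faces :=
  C.lift_mem_aug.resolve_left C.lift_nonempty.ne_empty

theorem lift_card (C : Crossing n M T D S l G p f c) : (partOver f (l G)).card = n := by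
  rw [← card_labels (C.unfolding.injOn_sphere C.lift_mem_aug), C.labels_facet, C.facet_card]

theorem notMem_lift (C : Crossing n M T D S l G p f c) : c ∉ partOver f (l G) := fun h =>
  C.fresh G C.mem (partOver_subset _ _ h)

theorem injOn_insert (C : Crossing n M T D S l G p f c) :
    Set.InjOn label (insert c (partOver f (l G)) : Finset ℕ) := by
  rw [Finset.coe_insert, Set.injOn_insert (by exact_mod_cast C.notMem_lift)]
  refine ⟨C.unfolding.injOn_sphere C.lift_mem_aug, ?_⟩
  rintro ⟨x, hx, hxc⟩
  exact C.label_notMem (hxc ▸ (mem_partOver.1 hx).2)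

theorem labels_insert_lift (C : Crossing n M T D S l G p f c) :
    labels (insert c (partOver f (l G))) = p := by
  rw [labels_insert, C.labels_facet, C.eq_insert]

/-- The only simplex of the sphere over the facet is its lift. -/
theorem eq_lift (C : Crossing n M T D S l G p f c) {s : Finset ℕ} (hs : s ∈ augFaces S)
    (hf : f ⊆ labels s) : s = partOver f (l G) := by
  obtain ⟨-, H, hH, hsH⟩ := C.unfolding.sphere_lift s hs
  have hHG : H = G := C.eq_of_mem hH
    (hf.trans (C.unfolding.labels_lift H hH ▸ labels_mono hsH))
  subst hHG
  refine (Finset.eq_of_subset_of_card_le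
    (partOver_subset_of_injOn (C.unfolding.injOn _ hH) hsH hf) ?_).symm
  rw [C.lift_card]
  exact C.unfolding.card_le hs

/-- The lift of `f` is a maximal simplex of the sphere and has an empty link, so the new simplexes
are just faces of the lift of `p`. -/
theorem mem_starring (C : Crossing n M T D S l G p f c) {s : Finset ℕ} :
    s ∈ augFaces (starring (partOver f (l G)) c S) ↔ ¬ partOver f (l G) ⊆ s ∧
      ((c ∉ s ∧ s ∈ augFaces S) ∨ (c ∈ s ∧ s ⊆ insert c (partOver f (l G)))) := by
  rw [mem_augFaces_starring C.lift_mem C.notMem_vertices]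
  refine and_congr_right fun _ => or_congr_right (and_congr_right fun _ => ?_)
  rw [Finset.subset_insert_iff]
  constructor
  · intro h
    have := Finset.eq_of_subset_of_card_le
      (Finset.subset_union_right (s₁ := s.erase c) (s₂ := partOver f (l G)))
      (by rw [C.lift_card]; exact C.unfolding.card_le h)
    rw [this]
    exact Finset.subset_union_left
  · intro h
    rw [Finset.union_eq_right.2 h]
    exact C.lift_mem_aug

/-- The unfolding with one more generator. -/
theorem unfolding_insert (C : Crossing n M T D S l G p f c) :
    Unfolding n M (insert p T) (insert f (insert p D)) (starring (partOver f (l G)) c S)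
      (Function.update l p (insert c (partOver f (l G)))) := by
  have U := C.unfolding
  have hp : Function.update l p (insert c (partOver f (l G))) p = insert c (partOver f (l G)) :=
    Function.update_self ..
  have hold : ∀ H ∈ T, Function.update l p (insert c (partOver f (l G))) H = l H := fun H hH =>
    Function.update_of_ne (show H ≠ p from fun h => C.notMem (h ▸ hH)) _ _
  have hfresh : ∀ H ∈ T, ∀ s ⊆ l H, c ∉ s := fun H hH s hs hc => C.fresh H hH (hs hc)
  generalize Function.update l p (insert c (partOver f (l G))) = l' at *
  refine ⟨U.normal, U.finite, ?_, ?_, ?_, ?_, ?_, ?_, ?_, ?_, ?_⟩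
  -- Gluing the lift of `p` to the ball along the lift of `f` replaces that facet of the boundary by
  -- the cone from `c` over its own boundary. This is a starring, undone by a weld.
  · exact Relation.ReflTransGen.head
      (.weld ⟨_, C.lift_mem, c, C.notMem_vertices, rfl⟩) U.sphere
  · exact Set.insert_subset C.gen U.subset
  · rintro H (rfl | hH)
    · rw [hp, C.labels_insert_lift]
    · rw [hold H hH, U.labels_lift H hH]
  · rintro H (rfl | hH)
    · rw [hp]
      exact C.injOn_insert
    · rw [hold H hH]
      exact U.injOn H hH
  · exact (Set.insert_subset_insert U.subset_deleted).trans (Set.subset_insert _ _)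
  · rintro A (rfl | rfl | hA)
    · refine Or.inr ⟨C.facet_mem, C.facet_card, G, Or.inr C.mem, p, Or.inl rfl, C.ne,
        partOver A (l G), ?_, ?_, C.labels_facet⟩
      · rw [hold G C.mem]
        exact partOver_subset _ _
      · rw [hp]
        exact Finset.subset_insert _ _
    · exact Or.inl (Or.inl rfl)
    · rcases U.deleted A hA with h | ⟨h1, h2, H, hH, I, hI, hne, s, hsH, hsI, hs⟩
      · exact Or.inl (Or.inr h)
      · exact Or.inr ⟨h1, h2, H, Or.inr hH, I, Or.inr hI, hne, s, by rwa [hold H hH],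
          by rwa [hold I hI], hs⟩
  · rintro H (rfl | hH) s hs hD
    · rw [hp] at hs
      rw [C.mem_starring]
      by_cases hc : c ∈ s
      · refine ⟨fun h => hD (Or.inr (Or.inl ?_)), Or.inr ⟨hc, hs⟩⟩
        rw [hs.antisymm (Finset.insert_subset hc h), C.labels_insert_lift]
      · have hs' := (Finset.subset_insert_iff_of_notMem hc).1 hs
        refine ⟨fun h => hD (Or.inl ?_), Or.inl ⟨hc, augFaces_of_subset C.lift_mem_aug hs'⟩⟩
        rw [hs'.antisymm h, C.labels_facet]
    · rw [hold H hH] at hs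
      have hsS := U.mem_sphere H hH s hs fun h => hD (Or.inr (Or.inr h))
      refine C.mem_starring.2 ⟨fun h => hD (Or.inl ?_), Or.inl ⟨hfresh H hH s hs, hsS⟩⟩
      rw [C.eq_lift hsS (C.labels_facet ▸ labels_mono h), C.labels_facet]
  · intro s hs
    rcases C.mem_starring.1 hs with ⟨hns, ⟨hc, hsS⟩ | ⟨hc, hsi⟩⟩
    · obtain ⟨hD, H, hH, hsH⟩ := U.sphere_lift s hsS
      refine ⟨?_, H, Or.inr hH, by rwa [hold H hH]⟩
      rintro (h | h | h)
      · exact hns (C.eq_lift hsS h.ge).ge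
      · have h1 := C.gen.2
        rw [← h, card_labels (U.injOn_sphere hsS)] at h1
        have := U.card_le hsS
        omega
      · exact hD h
    · have hlp : labels s ⊆ p := C.labels_insert_lift ▸ labels_mono hsi
      refine ⟨?_, p, Or.inl rfl, by rwa [hp]⟩
      rintro (h | h | h)
      · exact C.label_notMem (h ▸ label_mem_labels hc)
      · apply hns
        intro x hx
        refine partOver_subset_of_injOn (A := p) C.injOn_insert hsi h.ge (mem_partOver.2 ⟨?_, ?_⟩)
        · exact Finset.mem_insert_of_mem hx
        · exact C.facet_subset_new (mem_partOver.1 hx).2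
      -- If the names of `s` formed a previously deleted facet, that facet would lie in `p` and in
      -- two distinct generators of `T`.
      · rcases U.deleted _ h with h | ⟨h1, h2, H, hH, I, hI, hne, t, htH, htI, ht⟩
        · exact C.notMem (U.eq_of_subset (U.subset h) C.gen.1 hlp ▸ h)
        · have hH' : labels s ⊆ H := ht ▸ U.labels_lift H hH ▸ labels_mono htH
          have hI' : labels s ⊆ I := ht ▸ U.labels_lift I hI ▸ labels_mono htI
          rcases U.normal.two _ h1 (by omega) p ⟨C.gen.1, hlp, C.gen.2⟩ H
            (Unfolding.mem_gensOver U.subset hH hH') I (Unfolding.mem_gensOver U.subset hI hI')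
            with h | h | h
          · exact C.notMem (h ▸ hH)
          · exact C.notMem (h ▸ hI)
          · exact hne h
  · intro s hs hsc H hH I hI hsH hsI
    rcases C.mem_starring.1 hs with ⟨hns, ⟨hc, hsS⟩ | ⟨hc, hsi⟩⟩
    · have key : ∀ H ∈ insert p T, s ⊆ l' H → H ∈ T ∧ s ⊆ l H := by
        rintro H (rfl | hH) hsH
        · rw [hp, Finset.subset_insert_iff_of_notMem hc] at hsH
          exact absurd (Finset.eq_of_subset_of_card_le hsH (by rw [C.lift_card, hsc])).ge hns
        · exact ⟨hH, hold H hH ▸ hsH⟩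
      exact U.unique s hsS hsc H (key H hH hsH).1 I (key I hI hsI).1 (key H hH hsH).2
        (key I hI hsI).2
    · have key : ∀ H ∈ insert p T, s ⊆ l' H → H = p := by
        rintro H (rfl | hH) hsH
        · rfl
        · exact absurd hc (hfresh H hH s (hold H hH ▸ hsH))
      rw [key H hH hsH, key I hI hsI]

/-- The cell `.cone {c}` is the edge joining the apex to `c`. Away from `f` on one side and from
this edge on the other, the two complexes consist of literally the same cells. -/
theorem mem_cells_iff (C : Crossing n M T D S l G p f c) (x : Cell) :
    (x ∈ cells M D S ∧ ¬ Cell.base f ≤ x) ↔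
      (x ∈ cells M (insert f (insert p D)) (starring (partOver f (l G)) c S) ∧
        ¬ Cell.cone {c} ≤ x) := by
  rcases x with A | s
  · rw [base_mem_cells, base_mem_cells, Cell.base_le_base]
    simp only [Cell.not_cone_le_base, not_false_iff, and_true, Set.mem_insert_iff, not_or]
    constructor
    · rintro ⟨⟨h1, h2⟩, h3⟩
      refine ⟨h1, ?_, ?_, h2⟩
      · rintro rfl
        exact h3 subset_rfl
      · rintro rfl
        exact h3 C.facet_subset_new
    · rintro ⟨h1, h2, h3, h4⟩
      refine ⟨⟨h1, h4⟩, fun h => ?_⟩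
      have hA : A ∈ M.faces := h1.resolve_left fun h' =>
        (nonempty_of_mem C.facet_mem).ne_empty (Finset.subset_empty.1 (h' ▸ h))
      have hAc := C.unfolding.normal.dim A hA
      have hlt := Finset.card_lt_card (h.ssubset_of_ne (Ne.symm h2))
      rw [C.facet_card] at hlt
      rcases C.eq_or_eq ⟨hA, by omega⟩ h with h | h
      · exact h4 (h ▸ C.unfolding.subset_deleted C.mem)
      · exact h3 h
  · rw [cone_mem_cells, cone_mem_cells, Cell.base_le_cone, Cell.cone_le_cone,
      Finset.singleton_subset_iff, C.mem_starring]
    constructor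
    · rintro ⟨h1, h2⟩
      have hc := notMem_of_mem_augFaces C.notMem_vertices h1
      exact ⟨⟨fun h => h2 (C.labels_facet ▸ labels_mono h), Or.inl ⟨hc, h1⟩⟩, hc⟩
    · rintro ⟨⟨h1, ⟨-, h2⟩ | ⟨h2, -⟩⟩, h3⟩
      · exact ⟨h2, fun h => h1 (C.eq_lift h2 h).ge⟩
      · exact absurd h2 h3

theorem base_facet_le (C : Crossing n M T D S l G p f c) {z : Cell} (hz : z ∈ cells M D S)
    (h : Cell.base f ≤ z) :
    z = .base f ∨ z = .base p ∨ z = .cone (partOver f (l G)) := by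
  by_contra! hcon
  rcases z with A | s
  · have h1 : Cell.base A ∈ cells M (insert f (insert p D)) (starring (partOver f (l G)) c S) := by
      refine ⟨hz.1, ?_⟩
      rintro (rfl | rfl | h)
      · exact hcon.1 rfl
      · exact hcon.2.1 rfl
      · exact hz.2 h
    exact ((C.mem_cells_iff _).2 ⟨h1, Cell.not_cone_le_base⟩).2 h
  · exact hcon.2.2 (congrArg Cell.cone (C.eq_lift hz h))

theorem cone_le (C : Crossing n M T D S l G p f c) {z : Cell}
    (hz : z ∈ cells M (insert f (insert p D)) (starring (partOver f (l G)) c S))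
    (h : Cell.cone {c} ≤ z) : ∃ t, z = .cone t ∧ c ∈ t ∧ t ⊆ insert c (partOver f (l G)) := by
  rcases z with A | t
  · exact h.elim
  · have hc : c ∈ t := Finset.singleton_subset_iff.1 h
    refine ⟨t, rfl, hc, ?_⟩
    rcases (C.mem_starring.1 hz).2 with h | h
    · exact absurd hc h.1
    · exact h.2

theorem insert_mem_cells (C : Crossing n M T D S l G p f c) {s : Finset ℕ}
    (hs : s ⊂ partOver f (l G)) :
    .cone (insert c s) ∈ cells M (insert f (insert p D)) (starring (partOver f (l G)) c S) := by
  refine C.mem_starring.2 ⟨fun h => hs.2 ?_, Or.inr ⟨Finset.mem_insert_self _ _,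
    Finset.insert_subset_insert _ hs.1⟩⟩
  exact (Finset.subset_insert_iff_of_notMem C.notMem_lift).1 h

/-- Above `f` there are only `f`, `p` and the cone over the lift of `f`. A cell below both of the
latter is below `f`, so any other cell determines its upper bound. -/
theorem hasLocalJoins_facet (C : Crossing n M T D S l G p f c)
    (hf : Cell.base f ∈ cells M D S) : HasLocalJoins (cellPoset M D S) ⟨.base f, hf⟩ := by
  rintro ⟨x, hx⟩ - ⟨⟨z, hz⟩, hxz, hfz⟩
  by_cases hxf : x ≤ .base f
  · exact ⟨⟨.base f, hf⟩, ⟨hxf, le_rfl⟩, fun w hw => hw.2⟩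
  · refine ⟨⟨z, hz⟩, ⟨hxz, hfz⟩, ?_⟩
    rintro ⟨w, hw⟩ ⟨hxw, hfw⟩
    change x ≤ z at hxz
    change x ≤ w at hxw
    change z ≤ w
    have key : x ≤ .base p → ¬ x ≤ .cone (partOver f (l G)) := by
      intro h1 h2
      rcases x with A | s
      · rw [Cell.base_le_cone, C.labels_facet] at h2
        exact hxf h2
      · exact h1.elim
    rcases C.base_facet_le hz hfz with rfl | rfl | rfl <;>
      rcases C.base_facet_le hw hfw with rfl | rfl | rfl
    all_goals first
      | exact le_rfl
      | exact absurd hxz hxf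
      | exact absurd hxw hxf
      | exact absurd hxw (key hxz)
      | exact absurd hxz (key hxw)

/-- All cells above the edge are cones over faces of the lift of `p`, on which names are distinct.
Hence a base cell has a unique smallest set of vertices above it, and adding `c` gives the join. -/
theorem hasLocalJoins_vertex (C : Crossing n M T D S l G p f c)
    (hc : .cone {c} ∈ cells M (insert f (insert p D)) (starring (partOver f (l G)) c S)) :
    HasLocalJoins (cellPoset M (insert f (insert p D)) (starring (partOver f (l G)) c S))
      ⟨.cone {c}, hc⟩ := by
  rintro ⟨x, hx⟩ - ⟨⟨z, hz⟩, hxz, hcz⟩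
  change x ≤ z at hxz
  have hex : ∃ u, Cell.cone u ≤ z ∧ c ∈ u ∧ x ≤ .cone u ∧
      ∀ t, c ∈ t → t ⊆ insert c (partOver f (l G)) → x ≤ .cone t → u ⊆ t := by
    obtain ⟨t, rfl, hct, ht⟩ := C.cone_le hz hcz
    rcases x with A | s
    · have hle : ∀ t, c ∈ t → t ⊆ insert c (partOver f (l G)) → Cell.base A ≤ .cone t →
          insert c (partOver A (partOver f (l G))) ⊆ t := fun t hct ht hAt => by
        refine Finset.insert_subset hct (fun x hx => ?_)
        refine partOver_subset_of_injOn C.injOn_insert ht hAt ?_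
        rw [mem_partOver] at hx ⊢
        exact ⟨Finset.mem_insert_of_mem hx.1, hx.2⟩
      refine ⟨insert c (partOver A (partOver f (l G))), hle t hct ht hxz,
        Finset.mem_insert_self _ _, ?_, hle⟩
      intro v hv
      obtain ⟨y, hy, rfl⟩ := mem_labels.1 ((Cell.base_le_cone.1 hxz) hv)
      refine label_mem_labels ?_
      rcases Finset.mem_insert.1 (ht hy) with rfl | hy'
      · exact Finset.mem_insert_self _ _
      · exact Finset.mem_insert_of_mem (mem_partOver.2 ⟨hy', hv⟩)
    · exact ⟨insert c s, Finset.insert_subset hct hxz, Finset.mem_insert_self _ _,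
        Finset.subset_insert _ _, fun t hct _ hst => Finset.insert_subset hct hst⟩
  obtain ⟨u, huz, hcu, hxu, hmin⟩ := hex
  obtain ⟨t, rfl, -, -⟩ := C.cone_le hz hcz
  refine ⟨⟨.cone u, augFaces_of_subset hz huz⟩, ⟨hxu, Finset.singleton_subset_iff.2 hcu⟩, ?_⟩
  rintro ⟨w, hw⟩ ⟨hxw, hcw⟩
  obtain ⟨t', rfl, hct, ht⟩ := C.cone_le hw hcw
  exact hmin t' hct ht hxw

/-- On both sides the condition says that the cell belongs to `∂f ⋆ {a, b}`, the part over which the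
new vertex of the starring is coned. -/
theorem exists_upper_iff (C : Crossing n M T D S l G p f c) {x : Cell}
    (hx : x ∈ cells M D S) (hfx : ¬ Cell.base f ≤ x) :
    (∃ z ∈ cells M D S, x ≤ z ∧ Cell.base f ≤ z) ↔
      ∃ z ∈ cells M (insert f (insert p D)) (starring (partOver f (l G)) c S),
        x ≤ z ∧ Cell.cone {c} ≤ z := by
  constructor
  · rintro ⟨z, hz, hxz, hfz⟩
    rcases x with A | s
    · have hAp : A ⊆ p := by
        rcases C.base_facet_le hz hfz with rfl | rfl | rfl
        · exact (Cell.base_le_base.1 hxz).trans C.facet_subset_new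
        · exact hxz
        · rw [Cell.base_le_cone, C.labels_facet] at hxz
          exact hxz.trans C.facet_subset_new
      refine ⟨.cone (insert c (partOver A (partOver f (l G)))), C.insert_mem_cells
        ⟨partOver_subset _ _, fun h => hfx fun v hv => ?_⟩, fun v hv => ?_,
        Finset.singleton_subset_iff.2 (Finset.mem_insert_self _ _)⟩
      · rw [← C.labels_facet] at hv
        obtain ⟨y, hy, rfl⟩ := mem_labels.1 hv
        exact (mem_partOver.1 (h hy)).2
      · have := hAp hv
        rw [← C.labels_insert_lift] at this
        obtain ⟨y, hy, rfl⟩ := mem_labels.1 this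
        refine label_mem_labels ?_
        rcases Finset.mem_insert.1 hy with rfl | hy
        · exact Finset.mem_insert_self _ _
        · exact Finset.mem_insert_of_mem (mem_partOver.2 ⟨hy, hv⟩)
    · rcases C.base_facet_le hz hfz with rfl | rfl | rfl
      · exact hxz.elim
      · exact hxz.elim
      · exact ⟨.cone (insert c s), C.insert_mem_cells
          ⟨hxz, fun h => hfx (Cell.base_le_cone.2 (C.labels_facet ▸ labels_mono h))⟩,
          Finset.subset_insert _ _, Finset.singleton_subset_iff.2 (Finset.mem_insert_self _ _)⟩
  · rintro ⟨z, hz, hxz, hcz⟩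
    obtain ⟨t, rfl, -, ht⟩ := C.cone_le hz hcz
    rcases x with A | s
    · exact ⟨.base p, ⟨Or.inr C.gen.1, C.new_notMem_deleted⟩,
        (Cell.base_le_cone.1 hxz).trans (C.labels_insert_lift ▸ labels_mono ht),
        C.facet_subset_new⟩
    · refine ⟨.cone (partOver f (l G)), C.lift_mem_aug, ?_, C.labels_facet.ge⟩
      exact (Finset.subset_insert_iff_of_notMem
        (notMem_of_mem_augFaces C.notMem_vertices hx)).1 ((Cell.cone_le_cone.1 hxz).trans ht)

/-- Unfolding one more generator is a subdivision followed by a weld. -/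
theorem posetStellarEquiv (C : Crossing n M T D S l G p f c) :
    PosetStellarEquiv (cellPoset M D S)
      (cellPoset M (insert f (insert p D)) (starring (partOver f (l G)) c S)) := by
  have U' := C.unfolding_insert
  have hf : Cell.base f ∈ cells M D S := ⟨Or.inr C.facet_mem, C.facet_notMem_deleted⟩
  have hc : .cone {c} ∈ cells M (insert f (insert p D)) (starring (partOver f (l G)) c S) :=
    C.insert_mem_cells (s := ∅) (Finset.empty_ssubset.2 C.lift_nonempty)
  have hfbot : ¬ IsBot (⟨.base f, hf⟩ : cellPoset M D S) := fun h => by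
    have := h ⟨.base ∅, empty_mem_augFaces M, C.unfolding.empty_notMem_deleted⟩
    exact (nonempty_of_mem C.facet_mem).ne_empty (Finset.subset_empty.1 this)
  have hcbot : ¬ IsBot (⟨.cone {c}, hc⟩ : cellPoset M (insert f (insert p D))
      (starring (partOver f (l G)) c S)) := fun h =>
    Cell.not_cone_le_base (h ⟨.base ∅, empty_mem_augFaces M, U'.empty_notMem_deleted⟩)
  have hJ := C.hasLocalJoins_facet hf
  -- By `mem_cells_iff` the identity on cells serves as the isomorphism.
  let e : {x : cellPoset M D S // ¬ ⟨.base f, hf⟩ ≤ x} ≃o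
      {y : cellPoset M (insert f (insert p D)) (starring (partOver f (l G)) c S) //
        ¬ ⟨.cone {c}, hc⟩ ≤ y} :=
    { toFun := fun x => ⟨⟨x.1.1, ((C.mem_cells_iff _).1 ⟨x.1.2, x.2⟩).1⟩,
        ((C.mem_cells_iff _).1 ⟨x.1.2, x.2⟩).2⟩
      invFun := fun x => ⟨⟨x.1.1, ((C.mem_cells_iff _).2 ⟨x.1.2, x.2⟩).1⟩,
        ((C.mem_cells_iff _).2 ⟨x.1.2, x.2⟩).2⟩
      left_inv := fun _ => rfl
      right_inv := fun _ => rfl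
      map_rel_iff' := Iff.rfl }
  have he := posetStarring_congr hJ (C.hasLocalJoins_vertex hc) e (by
    intro x
    have := C.exists_upper_iff x.1.2 x.2
    constructor
    · rintro ⟨z, h1, h2⟩
      obtain ⟨w, hw, h3, h4⟩ := this.1 ⟨z.1, z.2, h1, h2⟩
      exact ⟨⟨w, hw⟩, h3, h4⟩
    · rintro ⟨z, h1, h2⟩
      obtain ⟨w, hw, h3, h4⟩ := this.2 ⟨z.1, z.2, h1, h2⟩
      exact ⟨⟨w, hw⟩, h3, h4⟩)
  have hS := C.unfolding.isSimplicialPoset.starring hfbot hJ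
  exact (Relation.ReflTransGen.single (.subdivision C.unfolding.isSimplicialPoset hS
    ⟨_, hfbot, ⟨OrderIso.refl _⟩⟩)).tail (.weld hS U'.isSimplicialPoset ⟨_, hcbot, he⟩)

end Crossing

/-! ### Unfolding all generators. -/

/-- A connected manifold with finitely many generators can be unfolded completely. -/
theorem exists_complete_unfolding {n : ℕ} {M : Complex} (hN : IsNormal (n + 1) M.faces)
    (hconn : IsConnected (realization M)) (hfin : (generators (n + 1) M).Finite) :
    ∃ D S l, Unfolding n M (generators (n + 1) M) D S l ∧
      PosetStellarEquiv (PartOrd.of (FacePoset M)) (cellPoset M D S) := by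
  have key : ∀ k, ∀ T D S l, Unfolding n M T D S l → T.Nonempty →
      (generators (n + 1) M \ T).ncard = k →
      PosetStellarEquiv (PartOrd.of (FacePoset M)) (cellPoset M D S) →
      ∃ D S l, Unfolding n M (generators (n + 1) M) D S l ∧
        PosetStellarEquiv (PartOrd.of (FacePoset M)) (cellPoset M D S) := by
    intro k
    induction k with
    | zero =>
      intro T D S l U _ hk hM
      rw [Set.ncard_eq_zero (hfin.subset Set.sdiff_subset), Set.sdiff_eq_empty] at hk
      have hT := U.subset.antisymm hk
      exact ⟨D, S, l, hT ▸ U, hM⟩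
    | succ k ih =>
      intro T D S l U hne hk hM
      have hT : T ⊂ generators (n + 1) M := U.subset.ssubset_of_ne fun h => by
        rw [h] at hk
        simp at hk
      obtain ⟨G, hG, p, hp, hpT, f, hf, hfG, hfp, hfc⟩ :=
        exists_crossing_facet hN hconn hfin hT hne
      obtain ⟨b, hb, hpb⟩ := exists_eq_insert_of_card hfp (by rw [hfc, hp.2])
      -- Infinitely many integers carry the name `b`, so one of them is unused by the finitely many
      -- lifts.
      obtain ⟨c, hc, rfl⟩ := exists_label_eq b U.finite_lift
      have C : Crossing n M T D S l G p f c :=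
        ⟨U, hG, hp, hpT, hf, hfG, hfc, hpb, hb, fun H hH h => hc (Set.mem_biUnion hH h)⟩
      refine ih _ _ _ _ C.unfolding_insert (Set.insert_nonempty _ _) ?_
        (hM.trans C.posetStellarEquiv)
      have h1 : generators (n + 1) M \ insert p T = (generators (n + 1) M \ T) \ {p} := by
        rw [Set.sdiff_sdiff, Set.union_singleton]
      rw [h1, Set.ncard_sdiff_singleton_of_mem (Set.mem_sdiff_of_mem hp hpT), hk]
      rfl
  obtain ⟨G, hG⟩ := exists_generator hN hconn
  exact key _ _ _ _ _ (unfolding_single hN hfin hG) (Set.singleton_nonempty G) rfl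
    (posetStellarEquiv_single hN hfin hG)
-- The regular equivalence on the sphere and the resulting stellar structure.
namespace Unfolding

variable {n : ℕ} {M S : Complex} {D : Set (Finset ℕ)} {l : Finset ℕ → Finset ℕ}

theorem eq_of_labels_eq (U : Unfolding n M (generators (n + 1) M) D S l) {G s t : Finset ℕ}
    (hG : G ∈ generators (n + 1) M) (hs : s ⊆ l G) (ht : t ⊆ l G) (h : labels s = labels t) :
    s = t := by
  rw [← partOver_labels (U.injOn G hG) hs, h, partOver_labels (U.injOn G hG) ht]

theorem labels_subset (U : Unfolding n M (generators (n + 1) M) D S l) {G s : Finset ℕ}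
    (hG : G ∈ generators (n + 1) M) (hs : s ⊆ l G) : labels s ⊆ G := by
  have := labels_mono hs
  rwa [U.labels_lift G hG] at this

theorem labels_mem_faces (U : Unfolding n M (generators (n + 1) M) D S l) {s : Finset ℕ}
    (hs : s ∈ S.faces) : labels s ∈ M.faces :=
  (U.labels_mem (Or.inr hs)).resolve_left ((nonempty_of_mem hs).image _).ne_empty

theorem lift_mem_augFaces (U : Unfolding n M (generators (n + 1) M) D S l) {G A : Finset ℕ}
    (hG : G ∈ generators (n + 1) M) (hA : A ⊆ G) (hAD : A ∉ D) :
    partOver A (l G) ∈ augFaces S ∧ labels (partOver A (l G)) = A := by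
  have h : labels (partOver A (l G)) = A := labels_partOver (by rwa [U.labels_lift G hG])
  exact ⟨U.mem_sphere G hG _ (partOver_subset _ _) (by rwa [h]), h⟩

/-- Equally named generators of `S` come from generators of `M` over one facet, and distinct ones
come from distinct generators of `M`. There are at most two of the latter. -/
theorem generator_unique (U : Unfolding n M (generators (n + 1) M) D S l) {g p q : Finset ℕ}
    (hg : g ∈ generators n S) (hp : p ∈ generators n S) (hq : q ∈ generators n S)
    (hpg : p ≠ g) (hqg : q ≠ g) (h1 : labels g = labels p) (h2 : labels g = labels q) :
    p = q := by
  obtain ⟨-, G, hG, hgG⟩ := U.sphere_lift g (Or.inr hg.1)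
  obtain ⟨-, H, hH, hpH⟩ := U.sphere_lift p (Or.inr hp.1)
  obtain ⟨-, I, hI, hqI⟩ := U.sphere_lift q (Or.inr hq.1)
  have hc : (labels g).card + 1 = n + 1 := by
    rw [card_labels (U.injOn_sphere (Or.inr hg.1)), hg.2]
  rcases U.normal.two (labels g) (U.labels_mem_faces hg.1) hc
    G (mem_gensOver U.subset hG (U.labels_subset hG hgG))
    H (mem_gensOver U.subset hH (h1 ▸ U.labels_subset hH hpH))
    I (mem_gensOver U.subset hI (h2 ▸ U.labels_subset hI hqI)) with h | h | h
  · subst h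
    exact absurd (U.eq_of_labels_eq hG hpH hgG h1.symm) hpg
  · subst h
    exact absurd (U.eq_of_labels_eq hG hqI hgG h2.symm) hqg
  · subst h
    exact U.eq_of_labels_eq hH hpH hqI (h1.symm.trans h2)

/-- The regular equivalence on the boundary sphere of a complete unfolding: vertices and generators
are equivalent when they have the same names. -/
def regularEquivalence (U : Unfolding n M (generators (n + 1) M) D S l) :
    RegularEquivalence n S where
  vert := Setoid.ker fun v => label v.1
  gen := Setoid.ker fun g => labels g.1
  vert_injective g _ _ hv hw h :=
    Subtype.ext (U.injOn_sphere (Or.inr g.2.1) hv hw h)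
  gen_unique g p q hp hq h1 h2 := Subtype.ext (U.generator_unique g.2 p.2 q.2
    (fun h => hp (Subtype.ext h)) (fun h => hq (Subtype.ext h)) h1 h2)
  gen_vert g p h v hv := by
    have hl : labels g.1 = labels p.1 := h
    have h1 := label_mem_labels hv
    rw [hl] at h1
    obtain ⟨w, hw, hwv⟩ := mem_labels.1 h1
    exact ⟨⟨w, mem_of_subset p.2.1 (by simpa using hw) (by simp)⟩, hw, hwv.symm⟩

theorem glued_labels (U : Unfolding n M (generators (n + 1) M) D S l) {s t : Finset ℕ}
    (h : U.regularEquivalence.Glued s t) :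
    s ∈ S.faces ∧ t ∈ augFaces S ∧ labels s = labels t := by
  rcases h with ⟨v, w, h⟩ | ⟨g, p, _, _, _, hs, hsg, htp, hst, hts⟩
  · have h' : label v.1 = label w.1 := h
    exact ⟨v.2, Or.inr w.2, by simp [labels, h']⟩
  · have hsS : s ∈ S.faces := mem_of_subset g.2.1 hsg hs
    have htS : t ∈ augFaces S := augFaces_of_subset (Or.inr p.2.1) htp
    refine ⟨hsS, htS, ?_⟩
    ext x
    constructor
    · intro hx
      obtain ⟨v, hv, rfl⟩ := mem_labels.1 hx
      obtain ⟨w, hw, hvw⟩ := hst ⟨v, mem_of_subset hsS (by simpa using hv) (by simp)⟩ hv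
      exact (show label v = label w.1 from hvw) ▸ label_mem_labels hw
    · intro hx
      obtain ⟨w, hw, rfl⟩ := mem_labels.1 hx
      obtain ⟨v, hv, hvw⟩ := hts ⟨w, by
        by_contra hc
        exact notMem_of_mem_augFaces hc htS hw⟩ hw
      exact (show label v.1 = label w from hvw) ▸ label_mem_labels hv

variable {a : ℕ}

/-- Simplexes of the sphere with the same names are identified. -/
theorem le_of_labels_eq (U : Unfolding n M (generators (n + 1) M) D S l)
    (x y : ConeCell a U.regularEquivalence) (hx : x.1 ∈ augFaces S) (hy : y.1 ∈ augFaces S)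
    (ha : a ∉ vertices S) (h : labels x.1 = labels y.1) : x ≤ y := by
  have hcone : ∀ s ∈ augFaces S, s ∈ augFaces (cone a S) := fun s hs => by
    rw [mem_augFaces_cone ha]
    exact augFaces_of_subset hs (Finset.erase_subset _ _)
  rcases hx with hx | hx
  · exact Relation.ReflTransGen.single (Or.inl (by rw [hx]; exact Finset.empty_subset _))
  have hA := U.labels_mem_faces hx
  obtain ⟨hAD, G, hG, hxG⟩ := U.sphere_lift x.1 (Or.inr hx)
  obtain ⟨-, H, hH, hyH⟩ := U.sphere_lift y.1 hy
  -- The generators around the common folded simplex are linked through facets; the lift of that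
  -- simplex is followed along such a chain from `G` to `H`.
  have hchain := U.normal.conn _ hA G (mem_gensOver U.subset hG (U.labels_subset hG hxG))
    H (mem_gensOver U.subset hH (h ▸ U.labels_subset hH hyH))
  have key : ∀ Z, Relation.ReflTransGen (AdjOver (n + 1) M.faces (labels x.1)) G Z →
      ∀ z : ConeCell a U.regularEquivalence, z.1 = partOver (labels x.1) (l Z) → x ≤ z := by
    intro Z hZ
    induction hZ with
    | refl =>
      intro z hz
      rw [partOver_labels (U.injOn G hG) hxG] at hz
      exact le_of_eq (Subtype.ext hz.symm)
    | @tail Y Z _ hYZ ih =>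
      intro z hz
      obtain ⟨hY, hZ, hc⟩ := hYZ
      have hYg : Y ∈ generators (n + 1) M := ⟨hY.1, hY.2.2⟩
      have hZg : Z ∈ generators (n + 1) M := ⟨hZ.1, hZ.2.2⟩
      obtain ⟨hyS, hyl⟩ := U.lift_mem_augFaces hYg hY.2.1 hAD
      obtain ⟨hzS, hzl⟩ := U.lift_mem_augFaces hZg hZ.2.1 hAD
      refine (ih ⟨_, hcone _ hyS⟩ rfl).trans ?_
      by_cases hne : Y = Z
      · subst hne
        exact le_of_eq (Subtype.ext hz.symm)
      have hAf : labels x.1 ⊆ Y ∩ Z := Finset.subset_inter hY.2.1 hZ.2.1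
      have hfM : Y ∩ Z ∈ M.faces := mem_of_subset hY.1 Finset.inter_subset_left
        ((nonempty_of_mem hA).mono hAf)
      have hfc : (Y ∩ Z).card = n := by
        have : (Y ∩ Z).card < Y.card := Finset.card_lt_card
          ⟨Finset.inter_subset_left, fun h => hne (Finset.eq_of_subset_of_card_le
            (h.trans Finset.inter_subset_right) (by rw [hY.2.2, hZ.2.2]))⟩
        rw [hY.2.2] at this
        omega
      -- A facet in `D` has a single lift, shared by `l Y` and `l Z`, so the two lifts of the
      -- simplex coincide.
      by_cases hfD : Y ∩ Z ∈ D
      · rcases U.deleted _ hfD with hf | ⟨-, -, I, hI, J, hJ, hIJ, e, heI, heJ, he⟩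
        · have := hf.2
          omega
        · have hmem : ∀ X ∈ generators (n + 1) M, Y ∩ Z ⊆ X → e ⊆ l X := by
            intro X hX hfX
            rcases U.normal.two _ hfM (by omega) X (mem_gensOver U.subset hX hfX)
              I (mem_gensOver U.subset hI (he ▸ U.labels_subset hI heI))
              J (mem_gensOver U.subset hJ (he ▸ U.labels_subset hJ heJ)) with h | h | h
            · rwa [h]
            · rwa [h]
            · exact absurd h hIJ
          have hlift : ∀ X ∈ generators (n + 1) M, Y ∩ Z ⊆ X →
              partOver (labels x.1) (l X) = partOver (labels x.1) e := by
            intro X hX hfX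
            have h1 := partOver_labels (U.injOn X hX)
              ((partOver_subset (labels x.1) e).trans (hmem X hX hfX))
            rwa [labels_partOver (by rwa [he])] at h1
          refine le_of_eq (Subtype.ext ?_)
          exact (hlift Y hYg Finset.inter_subset_left).trans
            (hz.trans (hlift Z hZg Finset.inter_subset_right)).symm
      -- A facet that is not deleted has lifts in `l Y` and `l Z` which are equivalent generators of
      -- `S`; the simplex is identified as a face of them.
      · obtain ⟨hgS, hgl⟩ := U.lift_mem_augFaces hYg Finset.inter_subset_left hfD
        obtain ⟨hpS, hpl⟩ := U.lift_mem_augFaces hZg Finset.inter_subset_right hfD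
        have hgen : ∀ s ∈ augFaces S, labels s = Y ∩ Z → s ∈ generators n S := by
          intro s hs hl
          refine ⟨hs.resolve_left ?_, ?_⟩
          · rintro rfl
            exact (nonempty_of_mem hfM).ne_empty hl.symm
          · rw [← card_labels (U.injOn_sphere hs), hl, hfc]
        have hvert : ∀ s ∈ augFaces S, ∀ v ∈ s, v ∈ vertices S := fun s hs v hv => by
          by_contra hc
          exact notMem_of_mem_augFaces hc hs hv
        have hcorr : ∀ s t, t ∈ augFaces S → labels s = labels t → ∀ v : vertices S, v.1 ∈ s →
            ∃ w : vertices S, w.1 ∈ t ∧ label v.1 = label w.1 := by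
          intro s t ht hl v hv
          have h1 := label_mem_labels hv
          rw [hl] at h1
          obtain ⟨w, hw, hwv⟩ := mem_labels.1 h1
          exact ⟨⟨w, hvert t ht w hw⟩, hw, hwv.symm⟩
        have hmono : ∀ X, partOver (labels x.1) (l X) ⊆ partOver (Y ∩ Z) (l X) := fun X v hv =>
          mem_partOver.2 ⟨(mem_partOver.1 hv).1, hAf (mem_partOver.1 hv).2⟩
        refine Relation.ReflTransGen.single (Or.inr ?_)
        rw [hz]
        refine .face ⟨_, hgen _ hgS hgl⟩ ⟨_, hgen _ hpS hpl⟩ (hgl.trans hpl.symm) _ _ ?_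
          (hmono Y) (hmono Z) (hcorr _ _ hzS (hyl.trans hzl.symm)) fun w hw => ?_
        · have := nonempty_of_mem hA
          rw [← hyl] at this
          exact Finset.image_nonempty.1 this
        · obtain ⟨v, hv, hvw⟩ := hcorr _ _ hyS (hzl.trans hyl.symm) w hw
          exact ⟨v, hv, hvw.symm⟩
  refine key H hchain y ?_
  rw [h, partOver_labels (U.injOn H hH) hyH]

/-- The stellar structure of a complete unfolding. -/
theorem cellPoset_orderIso (U : Unfolding n M (generators (n + 1) M) D S l)
    (ha : a ∉ vertices S) :
    Nonempty (cellPoset M D S ≃o PartOrd.of (StellarStructure a U.regularEquivalence)) := by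
  classical
  have hmem : ∀ x : ConeCell a U.regularEquivalence, x.1.erase a ∈ augFaces S := fun x =>
    (mem_augFaces_cone ha).1 x.2
  have hmem' : ∀ x : ConeCell a U.regularEquivalence, a ∉ x.1 → x.1 ∈ augFaces S := fun x h => by
    have := hmem x
    rwa [Finset.erase_eq_of_notMem h] at this
  -- Simplexes through `a` are kept apart, while simplexes of `S` retain only their names.
  let fold : ConeCell a U.regularEquivalence → Cell := fun x =>
    if a ∈ x.1 then .cone (x.1.erase a) else .base (labels x.1)
  have fold_pos : ∀ x : ConeCell a U.regularEquivalence, a ∈ x.1 →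
      fold x = .cone (x.1.erase a) := fun x h => if_pos h
  have fold_neg : ∀ x : ConeCell a U.regularEquivalence, a ∉ x.1 →
      fold x = .base (labels x.1) := fun x h => if_neg h
  have hcells : ∀ x, fold x ∈ cells M D S := by
    intro x
    by_cases h : a ∈ x.1
    · rw [fold_pos x h]
      exact hmem x
    · rw [fold_neg x h]
      exact ⟨U.labels_mem (hmem' x h), (U.sphere_lift _ (hmem' x h)).1⟩
  have hmono : ∀ x y : ConeCell a U.regularEquivalence, x ≤ y → fold x ≤ fold y := by
    intro x y hxy
    change Relation.ReflTransGen _ x y at hxy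
    induction hxy with
    | refl => exact le_rfl
    | @tail y z _ hyz ih =>
      refine ih.trans ?_
      rcases hyz with h | h
      · by_cases hy : a ∈ y.1
        · rw [fold_pos y hy, fold_pos z (h hy)]
          exact Finset.erase_subset_erase a h
        · by_cases hz : a ∈ z.1
          · rw [fold_neg y hy, fold_pos z hz]
            exact labels_mono (Finset.subset_erase.2 ⟨h, hy⟩)
          · rw [fold_neg y hy, fold_neg z hz]
            exact labels_mono h
      · obtain ⟨hy, hz, hl⟩ := U.glued_labels h
        rw [fold_neg y (notMem_of_mem_augFaces ha (Or.inr hy)),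
          fold_neg z (notMem_of_mem_augFaces ha hz), hl]
  -- The names of `x` select a face of `t` that is identified with `x`, and this face is included in
  -- `y`.
  have hsub : ∀ (x y : ConeCell a U.regularEquivalence) (t : Finset ℕ), a ∉ x.1 →
      t ∈ augFaces S → t ⊆ y.1 → labels x.1 ⊆ labels t → x ≤ y := by
    intro x y t hx ht hty hl
    have ht' : partOver (labels x.1) t ∈ augFaces S :=
      augFaces_of_subset ht (partOver_subset _ _)
    let z : ConeCell a U.regularEquivalence := ⟨partOver (labels x.1) t, by
      rw [mem_augFaces_cone ha]
      exact augFaces_of_subset ht' (Finset.erase_subset _ _)⟩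
    have h1 : x ≤ z := U.le_of_labels_eq x z (hmem' x hx) ht' ha (labels_partOver hl).symm
    exact h1.trans (Relation.ReflTransGen.single (Or.inl ((partOver_subset _ _).trans hty)))
  have hrefl : ∀ x y : ConeCell a U.regularEquivalence, fold x ≤ fold y → x ≤ y := by
    intro x y h
    by_cases hx : a ∈ x.1 <;> by_cases hy : a ∈ y.1
    · rw [fold_pos x hx, fold_pos y hy, Cell.cone_le_cone] at h
      refine Relation.ReflTransGen.single (Or.inl ?_)
      rw [← Finset.insert_erase hx, ← Finset.insert_erase hy]
      exact Finset.insert_subset_insert a h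
    · rw [fold_pos x hx, fold_neg y hy] at h
      exact h.elim
    · rw [fold_neg x hx, fold_pos y hy] at h
      exact hsub x y _ hx (hmem y) (Finset.erase_subset _ _) h
    · rw [fold_neg x hx, fold_neg y hy] at h
      exact hsub x y _ hx (hmem' y hy) subset_rfl h
  obtain ⟨e⟩ := antisymmetrization_orderIso
    (f := fun x => (⟨fold x, hcells x⟩ : cells M D S))
    (fun x y => ⟨hrefl x y, hmono x y⟩) (by
      rintro ⟨A | s, h⟩
      · have hlift : ∃ t ∈ augFaces S, labels t = A := by
          obtain ⟨rfl | hA, hAD⟩ := h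
          · exact ⟨∅, Or.inl rfl, rfl⟩
          · obtain ⟨G, hG⟩ := U.normal.pure A hA
            have := U.lift_mem_augFaces ⟨hG.1, hG.2.2⟩ hG.2.1 hAD
            exact ⟨_, this⟩
        obtain ⟨t, ht, rfl⟩ := hlift
        have hat := notMem_of_mem_augFaces ha ht
        let z : ConeCell a U.regularEquivalence := ⟨t, by
          rw [mem_augFaces_cone ha, Finset.erase_eq_of_notMem hat]
          exact ht⟩
        exact ⟨z, Subtype.ext (fold_neg z hat)⟩
      · have hs : s ∈ augFaces S := h
        have has := notMem_of_mem_augFaces ha hs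
        let z : ConeCell a U.regularEquivalence := ⟨insert a s, by
          rw [mem_augFaces_cone ha, Finset.erase_insert has]
          exact hs⟩
        refine ⟨z, Subtype.ext ((fold_pos z (Finset.mem_insert_self a s)).trans ?_)⟩
        exact congrArg Cell.cone (Finset.erase_insert has))
  exact ⟨e.symm⟩

end Unfolding
end Stellar

/-! ### The stellar structure theorem. -/

theorem mainTheorem5 (n : ℕ) (M : Stellar.Complex)
    (hM : Stellar.IsStellarManifold n M)
    (hconn : IsConnected (Stellar.realization M))
    (hfin : (Stellar.generators (n + 1) M).Finite) :
    ∃ (S : Stellar.Complex) (a : ℕ) (R : Stellar.RegularEquivalence n S),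
      a ∉ Stellar.vertices S ∧
      Stellar.IsStellarSphere n S ∧
      Stellar.AdmitsStellarStructure M a R ∧
      (Stellar.IsClosedComplex n M →
        ∀ g : Stellar.generators n S,
          ∃! p : Stellar.generators n S, p ≠ g ∧ R.gen g p) := by
  obtain ⟨D, S, l, U, hU⟩ := Stellar.exists_complete_unfolding hM.isNormal hconn hfin
  obtain ⟨a, ha⟩ := (U.finite_lift.subset U.vertices_subset).exists_notMem
  refine ⟨S, a, U.regularEquivalence, ha, U.sphere, ?_, fun hcl g => ?_⟩
  · obtain ⟨e⟩ := U.cellPoset_orderIso ha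
    exact Relation.ReflTransGen.tail hU
      (.relabelling U.isSimplicialPoset (U.isSimplicialPoset.of_orderIso e) ⟨e⟩)
  · obtain ⟨hD, G, hG, hgG⟩ := U.sphere_lift g.1 (Or.inr g.2.1)
    have hfc : (Stellar.labels g.1).card = n := by
      rw [Stellar.card_labels (U.injOn_sphere (Or.inr g.2.1)), g.2.2]
    -- Closedness gives a second generator `H` over the facet below `g`. That facet is not deleted,
    -- so its lift in `l H` belongs to `S` and is the partner of `g`.
    obtain ⟨H, hH, hHG, hfH⟩ := hcl.exists_ne hfin hG (U.labels_subset hG hgG) hfc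
    obtain ⟨hpS, hpl⟩ := U.lift_mem_augFaces hH hfH hD
    have hpc : (Stellar.partOver (Stellar.labels g.1) (l H)).card = n := by
      rw [← Stellar.card_labels (U.injOn_sphere hpS), hpl, hfc]
    have hp : Stellar.partOver (Stellar.labels g.1) (l H) ∈ Stellar.generators n S := by
      refine ⟨hpS.resolve_left fun h => ?_, hpc⟩
      rw [h] at hpl
      exact (Stellar.nonempty_of_mem (U.labels_mem_faces g.2.1)).ne_empty hpl.symm
    have hpg : (⟨_, hp⟩ : Stellar.generators n S) ≠ g := by
      intro h
      have h1 := congrArg Subtype.val h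
      dsimp only at h1
      -- Were the partner `g` itself, `g` would lie in the lifts of two different generators.
      exact hHG (U.unique g.1 (Or.inr g.2.1) g.2.2 H hH G hG
        (h1 ▸ Stellar.partOver_subset _ _) hgG)
    refine ⟨⟨_, hp⟩, ⟨hpg, hpl.symm⟩, fun q hq => ?_⟩
    exact U.regularEquivalence.gen_unique g q ⟨_, hp⟩ hq.1 hpg hq.2 hpl.symm
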